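/- Time is slotted. At the beginning of slot $t$, $M_t$ new unit-size contents appear; the $i$-th of them has a lifetime $K_{t,i}\ge 1$, that is, it is relevant in the slots $t,\dots,t+K_{t,i}-1$. The user accesses the system in slot $0$ and then at times separated by inter-access times $D_1,D_2,\dots\ge 1$. The sequences $(C_t)$, $(M_t)$, $(K_{t,i})$, $(D_n)$ are each i.i.d., are independent of each other, and take values in $[0,C_{\max}]$, $\{0,\dots,M_{\max}\}$, $\{1,\dots,K_{\max}\}$, $\{1,\dots,D_{\max}\}$; $C_t$ is the (continuously distributed) cost of downloading one content in slot $t$. Let $\mathcal O_t$ and $\mathcal I_t$ be the multisets of remaining lifetimes of the relevant contents outside and inside the user's cache (where $\mathcal O_t$ includes the contents new in slot $t$), and let $E_t$ be the time elapsed since the last access, so that $E_t=0$ iff the user accesses in slot $t$. In an access slot all of $\mathcal O_t$ is downloaded, everything relevant is consumed, and the next slot starts with an empty cache and only new contents outside it. In any other slot one chooses $A^{(1)}_t\subseteq\mathcal O_t$ to download into the cache and $A^{(2)}_t\subseteq\mathcal I_t$ to remove from it (they remain available outside the cache while relevant); then all lifetimes drop by one and expired contents vanish. The cost in slot $t$ is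 $|A^{(1)}_t|\,C_t$ (with $A^{(1)}_t=\mathcal O_t$ in access slots), and the aim is to minimize $\rho=\limsup_{T\to\infty}\mathbb E\big[\frac1T\sum_{t=1}^T|A^{(1)}_t|\,C_t\big]$ over all causal, possibly randomized, strategies that satisfy the capacity constraint $|\mathcal I_t|\le B$ for all $t$. Suppose that the capacity is unlimited, $B=\infty$. Then for every $E>0$ there are thresholds $0\le \mathcal T_1(E)\le\cdots\le \mathcal T_{K_{\max}}(E)\le C_{\max}$, depending on the state $(\mathcal O,\mathcal I,E)$ only through $E$, such that the following policy is optimal, that is, attains the least $\rho$ among all admissible strategies: in every state with $E>0$ and current channel cost $C$, each content outside the cache of remaining lifetime $L$ is downloaded if and only if $C\le\mathcal T_L(E)$, and nothing is removed from the cache. Consequently the cost $\rho$ of this policy is a lower bound (LB-UC) on the cost $\rho$ of every admissible strategy for any finite cache capacity $B$. -/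

import Mathlib

open MeasureTheory ProbabilityTheory Filter

noncomputable section

namespace Caching

/-- Contents have unit size and are described by their remaining lifetimes, so a collection of
contents is a multiset of positive integers. -/
abbrev Contents := Multiset ℕ

/-- An action `(A₁, A₂)`: the contents downloaded into the cache and the contents removed from it. -/
abbrev Action := Contents × Contents

/-- `age Z` is the multiset "`Z - 1`": every remaining lifetime drops by one slot and the contents
whose lifetime becomes `0` disappear. -/
def age (Z : Contents) : Contents := (Z.map (fun z => z - 1)).filter (fun z => 0 < z)

/-- The controllable state `x = (O, I, E)`: relevant contents outside the cache, relevant contents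
in the cache, and the time elapsed since the last user access. -/
structure State where
  /-- relevant contents that are not in the cache -/
  out : Contents
  /-- relevant contents that are in the cache -/
  cache : Contents
  /-- number of slots since the last access (`0` means that the user accesses now) -/
  elapsed : ℕ

/-- A deterministic stationary policy: an action for every state `x` and channel cost `c`. -/
abbrev Policy := State → ℝ → Action

/-- A strategy in full generality: the action taken in every slot, as a random process. -/
abbrev Strategy (Ω : Type*) := ℕ → Ω → Action

/-- The threshold policy for unlimited cache capacity with thresholds `τ E L`. If the user accesses
(`E = 0`) everything relevant is delivered and the cache is emptied. If `E > 0`, a content of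
remaining lifetime `L` outside the cache is downloaded iff `c ≤ τ E L`, and nothing is removed. -/
def thresholdPolicy (τ : ℕ → ℕ → ℝ) : Policy := fun x c =>
  if x.elapsed = 0 then (x.out, x.cache)
  else (x.out.filter (fun L => c ≤ τ x.elapsed L), 0)

/-- The exogenous random sequences: channel costs `C t`, numbers `M t` of new contents, lifetimes
`K t i` of the contents that are new in slot `t` (those with `i < M t`), inter-access times `D n`. -/
structure System (Ω : Type*) where
  /-- channel cost in slot `t` -/
  C : ℕ → Ω → ℝ
  /-- number of contents generated in slot `t` -/
  M : ℕ → Ω → ℕ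
  /-- lifetime of the `i`-th content generated in slot `t` -/
  K : ℕ → ℕ → Ω → ℕ
  /-- `n`-th inter-access time -/
  D : ℕ → Ω → ℕ

namespace System

variable {Ω : Type*} (S : System Ω)

/-- The multiset of contents generated at the beginning of slot `t`. -/
def newContents (t : ℕ) (ω : Ω) : Contents := (Multiset.range (S.M t ω)).map (fun i => S.K t i ω)

/-- `U_t = 1`: the user accesses in slot `t`. There is an access in slot `0`, and the gaps between
consecutive accesses are `D 0, D 1, …`. -/
def IsAccess (t : ℕ) (ω : Ω) : Prop := ∃ n, ∑ k ∈ Finset.range n, S.D k ω = t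

/-- `E_t = min {t - n : 0 ≤ n ≤ t, U_n = 1}`. -/
def elapsed (t : ℕ) (ω : Ω) : ℕ := sInf {e | ∃ n, n ≤ t ∧ S.IsAccess n ω ∧ e = t - n}

open Classical in
/-- One step of the dynamics, from the state `x` in slot `t` to the state in slot `t + 1`. -/
def step (t : ℕ) (ω : Ω) (x : State) (a : Action) : State :=
  if S.IsAccess t ω then
    ⟨S.newContents (t + 1) ω, 0, S.elapsed (t + 1) ω⟩
  else
    ⟨age (x.out + a.2 - a.1) + S.newContents (t + 1) ω, age (x.cache + a.1 - a.2),
      S.elapsed (t + 1) ω⟩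

/-- Initially there are no contents. As slot `0` is an access slot, which resets the contents, and
costs are counted from slot `1` on, the initial contents do not matter. -/
def initial (ω : Ω) : State := ⟨0, 0, S.elapsed 0 ω⟩

/-- The state process under a strategy. -/
def state (A : Strategy Ω) : ℕ → Ω → State
  | 0, ω => S.initial ω
  | t + 1, ω => S.step t ω (state A t ω) (A t ω)

/-- The state process when the policy `π` is followed. -/
def policyState (π : Policy) : ℕ → Ω → State
  | 0, ω => S.initial ω
  | t + 1, ω => S.step t ω (policyState π t ω) (π (policyState π t ω) (S.C t ω))

/-- The strategy that consists in following the policy `π`. -/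
def follow (π : Policy) : Strategy Ω := fun t ω => π (S.policyState π t ω) (S.C t ω)

theorem state_follow (π : Policy) (t : ℕ) (ω : Ω) :
    S.state (S.follow π) t ω = S.policyState π t ω := by
  induction t with
  | zero => rfl
  | succ t ih => simp only [state, policyState, ih, follow]

/-- The σ-algebra generated by all the exogenous sequences. -/
@[reducible]
def noise : MeasurableSpace Ω :=
  (⨆ t, MeasurableSpace.comap (S.C t) inferInstance) ⊔
  (⨆ t, MeasurableSpace.comap (S.M t) ⊤) ⊔
  (⨆ t, ⨆ i, MeasurableSpace.comap (S.K t i) ⊤) ⊔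
  (⨆ n, MeasurableSpace.comap (S.D n) ⊤)

/-- What has been observed when the decision of slot `t` is taken: channel costs, new contents and
accesses of the slots `0, …, t`. -/
@[reducible]
def history (t : ℕ) : MeasurableSpace Ω :=
  ⨆ s, ⨆ _ : s ≤ t,
    MeasurableSpace.comap (S.C s) inferInstance ⊔
    MeasurableSpace.comap (S.newContents s) ⊤ ⊔
    MeasurableSpace.comap (S.IsAccess s) ⊤

/-- The probabilistic assumptions on the exogenous sequences. -/
structure IsModel [MeasurableSpace Ω] (P : Measure Ω) (Cmax : ℝ) (Mmax Kmax Dmax : ℕ) :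
    Prop where
  measurable_C : ∀ t, Measurable (S.C t)
  measurable_M : ∀ t, Measurable (S.M t)
  measurable_K : ∀ t i, Measurable (S.K t i)
  measurable_D : ∀ n, Measurable (S.D n)
  /-- each sequence is i.i.d. -/
  indep_C : iIndepFun S.C P
  ident_C : ∀ t, IdentDistrib (S.C t) (S.C 0) P P
  indep_M : iIndepFun S.M P
  ident_M : ∀ t, IdentDistrib (S.M t) (S.M 0) P P
  indep_K : iIndepFun (fun p : ℕ × ℕ => S.K p.1 p.2) P
  ident_K : ∀ t i, IdentDistrib (S.K t i) (S.K 0 0) P P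
  indep_D : iIndepFun S.D P
  ident_D : ∀ n, IdentDistrib (S.D n) (S.D 0) P P
  /-- the four sequences are independent of each other -/
  indep : iIndep ![⨆ t, MeasurableSpace.comap (S.C t) inferInstance,
    ⨆ t, MeasurableSpace.comap (S.M t) ⊤,
    ⨆ t, ⨆ i, MeasurableSpace.comap (S.K t i) ⊤,
    ⨆ n, MeasurableSpace.comap (S.D n) ⊤] P
  /-- the channel cost is a continuous random variable -/
  continuous_C : Continuous (cdf (P.map (S.C 0)))
  C_mem : ∀ t ω, 0 ≤ S.C t ω ∧ S.C t ω ≤ Cmax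
  M_le : ∀ t ω, S.M t ω ≤ Mmax
  K_mem : ∀ t i ω, 1 ≤ S.K t i ω ∧ S.K t i ω ≤ Kmax
  D_mem : ∀ n ω, 1 ≤ S.D n ω ∧ S.D n ω ≤ Dmax

/-- Admissible (causal) strategies for the cache capacity `B`, where `B = ⊤` is unlimited capacity.
The actions may be randomized: `𝒢` is a source of randomness independent of the system. -/
structure IsAdmissible [mΩ : MeasurableSpace Ω] (P : Measure Ω) (B : ℕ∞) (A : Strategy Ω) :
    Prop where
  /-- only contents outside the cache are downloaded, only contents in the cache are removed -/
  subset : ∀ t ω, (A t ω).1 ≤ (S.state A t ω).out ∧ (A t ω).2 ≤ (S.state A t ω).cache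
  /-- an access requests and consumes all the relevant contents -/
  access : ∀ t ω, S.IsAccess t ω → A t ω = ((S.state A t ω).out, (S.state A t ω).cache)
  /-- the cache capacity is respected -/
  capacity : ∀ t ω, ((S.state A t ω).cache.card : ℕ∞) ≤ B
  /-- causality: the action of slot `t` is determined by the history up to slot `t` and by
  independent randomization -/
  causal : ∃ 𝒢 : MeasurableSpace Ω, 𝒢 ≤ mΩ ∧ Indep 𝒢 S.noise P ∧
    ∀ t (a : Action), MeasurableSet[𝒢 ⊔ S.history t] {ω | A t ω = a}

/-- The energy cost averaged over the slots `1, …, T`. -/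
def averageCost (A : Strategy Ω) (T : ℕ) (ω : Ω) : ℝ :=
  (1 / (T : ℝ)) * ∑ t ∈ Finset.Icc 1 T, ((A t ω).1.card : ℝ) * S.C t ω

/-- The long-term average energy cost `ρ = limsup_T 𝔼[J_T]`. -/
def longTermCost [MeasurableSpace Ω] (P : Measure Ω) (A : Strategy Ω) : ℝ :=
  limsup (fun T : ℕ => ∫ ω, S.averageCost A T ω ∂P) atTop

/-- `A` is optimal for the cache capacity `B`: it is admissible and has the least long-term average
cost among all admissible strategies. -/
def IsOptimal [MeasurableSpace Ω] (P : Measure Ω) (B : ℕ∞) (A : Strategy Ω) : Prop :=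
  S.IsAdmissible P B A ∧
    ∀ A', S.IsAdmissible P B A' → S.longTermCost P A ≤ S.longTermCost P A'

end System

end Caching

end

noncomputable section

namespace Caching

/-! With unlimited capacity the contents do not compete for space, so the problem splits into one
optimal stopping problem per content. `waitingCost P e L` is the value of that problem: a content
left outside, with `L` further slots of relevance and the last access `e` slots ago, must be bought
at the going price if the user accesses next (probability `hazard P e`). Otherwise it costs the
smaller of the next price and the value of waiting again. Downloading now is right iff the price
does not exceed this value, so the threshold for remaining lifetime `z` is `waitingCost P e (z -
1)`. It is monotone in `z` because longer relevance can only raise the cost of waiting.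

Optimality is a verification argument with the potential `expectedDebt`, the expected total of the
single-content values (`contentCost`) over the contents outside the cache. For every causal
strategy, debt now plus new debt is at most the present cost plus the next debt (`expectedDebt_le`),
with equality for the threshold policy (`expectedDebt_follow`). Pathwise this is `total_min_le`
against `total_min_eq`; a removal only adds nonnegative waiting cost. Telescoping compares both
strategies with the same sum of new debts. The debt is bounded, because boundedly many relevant
contents exist at a time, so the averages differ by at most a constant over `T` in the wrong
direction.

Two probabilistic facts turn the pathwise inequality into one in expectation. The channel cost of
slot `t` is independent of the state in slot `t` (`indepFun_state_C`), and `hazard` at the elapsed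
time is the conditional probability of an access in the next slot given the past and the
randomization (`setIntegral_hazard`). -/

/-! ### Aging of contents and sums over their lifetimes -/

theorem countP_age_le (j : ℕ) (Z : Contents) :
    (age Z).countP (fun z => j ≤ z) ≤ Z.countP (fun z => j + 1 ≤ z) := by
  unfold age
  rw [Multiset.countP_filter, Multiset.countP_map, Multiset.countP_eq_card_filter]
  refine Multiset.card_le_card (Multiset.monotone_filter_right _ ?_)
  intro a ha
  omega

theorem age_add (Y Z : Contents) : age (Y + Z) = age Y + age Z := by
  simp [age]

/-- The sum of `f` over the remaining lifetimes of a collection of contents. -/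
def total (f : ℕ → ℝ) (Z : Contents) : ℝ := (Z.map f).sum

@[simp] theorem total_zero (f : ℕ → ℝ) : total f 0 = 0 := by simp [total]

@[simp] theorem total_cons (f : ℕ → ℝ) (a : ℕ) (Z : Contents) :
    total f (a ::ₘ Z) = f a + total f Z := by simp [total]

@[simp] theorem total_add (f : ℕ → ℝ) (Y Z : Contents) :
    total f (Y + Z) = total f Y + total f Z := by simp [total]

theorem total_nonneg {f : ℕ → ℝ} (hf : ∀ z, 0 ≤ f z) (Z : Contents) : 0 ≤ total f Z := by
  induction Z using Multiset.induction with
  | empty => simp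
  | cons a Z ih => rw [total_cons]; have := hf a; linarith

theorem total_le_card_mul {f : ℕ → ℝ} {b : ℝ} (hf : ∀ z, f z ≤ b) (Z : Contents) :
    total f Z ≤ Z.card * b := by
  induction Z using Multiset.induction with
  | empty => simp
  | cons a Z ih =>
    rw [total_cons, Multiset.card_cons]
    push_cast
    have := hf a
    linarith

theorem total_const (b : ℝ) (Z : Contents) : total (fun _ => b) Z = Z.card * b := by
  simp [total]

/-- Aging discards contents that reach lifetime `0`; `f 0 = 0` lets the right-hand side keep them at
no cost. -/
theorem total_age {f : ℕ → ℝ} (hf : f 0 = 0) (Z : Contents) :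
    total f (age Z) = total (fun z => f (z - 1)) Z := by
  induction Z using Multiset.induction with
  | empty => simp [age]
  | cons a Z ih =>
    rw [total_cons, ← ih]
    unfold age
    rw [Multiset.map_cons, Multiset.filter_cons]
    split_ifs with h
    · simp [total]
    · rw [Nat.eq_zero_of_not_pos h, hf]; simp

theorem total_congr {f g : ℕ → ℝ} {Z : Contents} (h : ∀ z ∈ Z, f z = g z) :
    total f Z = total g Z := by
  unfold total; rw [Multiset.map_congr rfl h]

/-- Downloading a subcollection at unit cost `c` and paying `f` for the rest costs at least
`min c f` for each content. -/
theorem total_min_le {f : ℕ → ℝ} (hf : ∀ z, 0 ≤ f z) (c : ℝ) {O A R : Contents} (hA : A ≤ O) :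
    total (fun z => min c (f z)) O ≤ A.card * c + total f (O + R - A) := by
  obtain ⟨Y, rfl⟩ := Multiset.le_iff_exists_add.1 hA
  have h1 : A + Y + R - A = Y + R := by rw [add_assoc, add_tsub_cancel_left]
  have h2 : total (fun z => min c (f z)) A ≤ A.card * c :=
    total_le_card_mul (fun z => min_le_left _ _) A
  have h3 : total (fun z => min c (f z)) Y ≤ total f Y := by
    induction Y using Multiset.induction with
    | empty => simp
    | cons a Z ih =>
      have := ih (Multiset.le_add_right _ _) (by rw [add_assoc, add_tsub_cancel_left])
      have := min_le_right c (f a)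
      rw [total_cons, total_cons]; linarith
  -- Removed contents `R` only contribute nonnegative cost: this is why an optimal policy need not
  -- remove anything.
  have h4 := total_nonneg hf R
  rw [h1, total_add, total_add]
  linarith

/-- The threshold rule chooses the smaller of `c` and `f z` for each content separately. The `+ 0`
stands for the empty set of removals, matching the shape of `remainder`. -/
theorem total_min_eq (f : ℕ → ℝ) (c : ℝ) (O : Contents) :
    ((O.filter (fun z => c ≤ f z)).card : ℝ) * c + total f (O + 0 - O.filter (fun z => c ≤ f z)) =
      total (fun z => min c (f z)) O := by
  have h : O + 0 - O.filter (fun z => c ≤ f z) = O.filter (fun z => ¬ c ≤ f z) := by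
    conv_lhs => rw [add_zero]; enter [1]; rw [← Multiset.filter_add_not (fun z => c ≤ f z) O]
    rw [add_tsub_cancel_left]
  rw [h]
  clear h
  induction O using Multiset.induction with
  | empty => simp
  | cons a O ih =>
    by_cases ha : c ≤ f a
    · rw [Multiset.filter_cons_of_pos (p := fun z => c ≤ f z) _ ha,
        Multiset.filter_cons_of_neg (p := fun z => ¬ c ≤ f z) _ (by simpa using ha),
        total_cons, ← ih, min_eq_left ha, Multiset.card_cons]
      push_cast
      ring
    · rw [Multiset.filter_cons_of_neg (p := fun z => c ≤ f z) _ ha,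
        Multiset.filter_cons_of_pos (p := fun z => ¬ c ≤ f z) _ ha,
        total_cons, total_cons, ← ih, min_eq_right (le_of_not_ge ha)]
      ring

/-! ### Access times and elapsed time, path by path -/

namespace System

variable {Ω : Type*} (S : System Ω)

theorem isAccess_zero (ω : Ω) : S.IsAccess 0 ω := ⟨0, by simp⟩

theorem exists_elapsed_eq (t : ℕ) (ω : Ω) :
    ∃ n, n ≤ t ∧ S.IsAccess n ω ∧ S.elapsed t ω = t - n :=
  Nat.sInf_mem (s := {e | ∃ n, n ≤ t ∧ S.IsAccess n ω ∧ e = t - n})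
    ⟨t, 0, Nat.zero_le _, S.isAccess_zero ω, rfl⟩

theorem elapsed_le {t n : ℕ} {ω : Ω} (hn : n ≤ t) (h : S.IsAccess n ω) :
    S.elapsed t ω ≤ t - n :=
  Nat.sInf_le ⟨n, hn, h, rfl⟩

theorem elapsed_eq_zero_iff (t : ℕ) (ω : Ω) : S.elapsed t ω = 0 ↔ S.IsAccess t ω := by
  constructor
  · intro h
    obtain ⟨n, hn, ha, he⟩ := S.exists_elapsed_eq t ω
    obtain rfl : n = t := by omega
    exact ha
  · intro h
    have := S.elapsed_le le_rfl h
    omega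

open Classical in
theorem elapsed_succ (t : ℕ) (ω : Ω) :
    S.elapsed (t + 1) ω = if S.IsAccess (t + 1) ω then 0 else S.elapsed t ω + 1 := by
  split_ifs with h
  · exact (S.elapsed_eq_zero_iff _ ω).2 h
  · obtain ⟨n, hn, ha, he⟩ := S.exists_elapsed_eq t ω
    obtain ⟨m, hm, hb, hf⟩ := S.exists_elapsed_eq (t + 1) ω
    have h1 := S.elapsed_le (n := n) (t := t + 1) (by omega) ha
    have h2 : m ≠ t + 1 := by rintro rfl; exact h hb
    have h3 := S.elapsed_le (n := m) (t := t) (by omega) hb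
    omega

/-- The time of the `n`-th access. -/
def accessTime (n : ℕ) (ω : Ω) : ℕ := ∑ k ∈ Finset.range n, S.D k ω

theorem accessTime_succ (n : ℕ) (ω : Ω) :
    S.accessTime (n + 1) ω = S.accessTime n ω + S.D n ω := Finset.sum_range_succ _ _

theorem accessTime_strictMono {ω : Ω} (hD : ∀ n, 1 ≤ S.D n ω) :
    StrictMono (fun n => S.accessTime n ω) :=
  strictMono_nat_of_lt_succ fun n => by
    have := S.accessTime_succ n ω
    have := hD n
    omega

/-- The event that the last access up to slot `t` is the `n`-th one, `e` slots ago. -/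
def lastAccess (t : ℕ) (p : ℕ × ℕ) : Set Ω :=
  {ω | S.accessTime p.1 ω + p.2 = t ∧ p.2 < S.D p.1 ω}

/-- The point is the bound `m ≤ n`: on this event the accesses up to slot `t` are determined by the
gaps before the `n`-th one. -/
theorem isAccess_iff_of_mem_lastAccess {t n e : ℕ} {ω : Ω} (hD : ∀ n, 1 ≤ S.D n ω)
    (h : ω ∈ S.lastAccess t (n, e)) {s : ℕ} (hs : s ≤ t) :
    S.IsAccess s ω ↔ ∃ m ≤ n, S.accessTime m ω = s := by
  constructor
  · rintro ⟨m, hm⟩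
    refine ⟨m, ?_, hm⟩
    by_contra hmn
    have hmn : n + 1 ≤ m := by omega
    have h1 := (S.accessTime_strictMono hD).monotone hmn
    have h2 := S.accessTime_succ n ω
    have h3 : S.accessTime m ω = s := hm
    obtain ⟨h4, h5⟩ := h
    simp only at h1 h4 h5
    omega
  · rintro ⟨m, -, hm⟩
    exact ⟨m, hm⟩

theorem elapsed_eq_of_mem_lastAccess {t n e : ℕ} {ω : Ω} (hD : ∀ n, 1 ≤ S.D n ω)
    (h : ω ∈ S.lastAccess t (n, e)) : S.elapsed t ω = e := by
  obtain ⟨m, hm, ha, he⟩ := S.exists_elapsed_eq t ω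
  obtain ⟨k, hk, hkm⟩ := (S.isAccess_iff_of_mem_lastAccess hD h hm).1 ha
  have h1 := (S.accessTime_strictMono hD).monotone hk
  obtain ⟨h4, h5⟩ := h
  have h2 := S.elapsed_le (t := t) (n := S.accessTime n ω) (by simp only at h4; omega) ⟨n, rfl⟩
  simp only at h1 h4 h5
  omega

theorem isAccess_succ_iff_of_mem_lastAccess {t n e : ℕ} {ω : Ω} (hD : ∀ n, 1 ≤ S.D n ω)
    (h : ω ∈ S.lastAccess t (n, e)) : S.IsAccess (t + 1) ω ↔ S.D n ω = e + 1 := by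
  have h2 := S.accessTime_succ n ω
  obtain ⟨h4, h5⟩ := h
  simp only at h4 h5
  constructor
  · rintro ⟨m, hm⟩
    have hm : S.accessTime m ω = t + 1 := hm
    have h3 : n < m := (S.accessTime_strictMono hD).lt_iff_lt.1 (by omega)
    have h1 := (S.accessTime_strictMono hD).monotone (Nat.succ_le_of_lt h3)
    simp only [Nat.succ_eq_add_one] at h1
    omega
  · intro h
    refine ⟨n + 1, ?_⟩
    change S.accessTime (n + 1) ω = _
    omega

theorem pairwise_disjoint_lastAccess (hD : ∀ n ω, 1 ≤ S.D n ω) (t : ℕ) :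
    Pairwise (Function.onFun Disjoint (S.lastAccess t)) := by
  rintro ⟨n, e⟩ ⟨m, f⟩ hne
  refine Set.disjoint_left.2 fun ω h1 h2 => hne ?_
  have h3 := S.elapsed_eq_of_mem_lastAccess (fun n => hD n ω) h1
  have h4 := S.elapsed_eq_of_mem_lastAccess (fun n => hD n ω) h2
  obtain ⟨h5, -⟩ := h1
  obtain ⟨h6, -⟩ := h2
  simp only at h5 h6
  have h7 : n = m := (S.accessTime_strictMono (fun n => hD n ω)).injective (by omega)
  rw [Prod.mk.injEq]
  omega

theorem iUnion_lastAccess (hD : ∀ n ω, 1 ≤ S.D n ω) (t : ℕ) :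
    ⋃ p, S.lastAccess t p = Set.univ := by
  refine Set.eq_univ_of_forall fun ω => Set.mem_iUnion.2 ?_
  obtain ⟨m, hm, ⟨n, hn⟩, he⟩ := S.exists_elapsed_eq t ω
  have hn : S.accessTime n ω = m := hn
  refine ⟨(n, S.elapsed t ω), ?_, ?_⟩
  · simp only; omega
  · simp only
    by_contra hlt
    have h1 := S.accessTime_succ n ω
    have h2 := hD n ω
    have h3 := S.elapsed_le (t := t) (n := S.accessTime (n + 1) ω) (by omega) ⟨n + 1, rfl⟩
    omega

/-! ### Pathwise dynamics: bounds on the contents and the one-slot inequality -/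

theorem state_elapsed (A : Strategy Ω) (t : ℕ) (ω : Ω) :
    (S.state A t ω).elapsed = S.elapsed t ω := by
  cases t with
  | zero => rfl
  | succ t =>
    simp only [state, step]
    split_ifs <;> rfl

open Classical in
/-- The contents generated up to slot `t` that are still outside the cache at the beginning of
slot `t + 1`. -/
def remainder (A : Strategy Ω) (t : ℕ) (ω : Ω) : Contents :=
  if S.IsAccess t ω then 0 else age ((S.state A t ω).out + (A t ω).2 - (A t ω).1)

theorem state_succ_out (A : Strategy Ω) (t : ℕ) (ω : Ω) :
    (S.state A (t + 1) ω).out = S.remainder A t ω + S.newContents (t + 1) ω := by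
  simp only [state, step, remainder]
  split_ifs
  · simp
  · rfl

/-- The actions are feasible and everything is delivered in access slots. -/
structure IsFeasible (A : Strategy Ω) : Prop where
  subset : ∀ t ω, (A t ω).1 ≤ (S.state A t ω).out ∧ (A t ω).2 ≤ (S.state A t ω).cache
  access : ∀ t ω, S.IsAccess t ω → A t ω = ((S.state A t ω).out, (S.state A t ω).cache)

/-- A surviving content of lifetime at least `j` had lifetime at least `j + 1` one slot earlier, and
at most `Mmax` new ones join, none of lifetime above `Kmax`. The count is refined by `j` so that the
induction on `t` closes. Cache and outside are counted together because downloads and removals only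
move contents between them. -/
theorem countP_state_le {Mmax Kmax : ℕ} (hM : ∀ t ω, S.M t ω ≤ Mmax)
    (hK : ∀ t i ω, S.K t i ω ≤ Kmax) {A : Strategy Ω} (hA : S.IsFeasible A) (t : ℕ) (ω : Ω) :
    ∀ j, 1 ≤ j → ((S.state A t ω).out + (S.state A t ω).cache).countP (fun z => j ≤ z) ≤
      Mmax * (Kmax + 1 - j) := by
  induction t with
  | zero => intro j _; simp [state, initial]
  | succ t ih =>
    intro j hj
    have hnew : (S.newContents (t + 1) ω).countP (fun z => j ≤ z) ≤
        if j ≤ Kmax then Mmax else 0 := by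
      split_ifs with h
      · refine (Multiset.countP_le_card _ _).trans ?_
        simpa [newContents] using hM (t + 1) ω
      · rw [Nat.le_zero, Multiset.countP_eq_zero]
        intro z hz
        simp only [newContents, Multiset.mem_map] at hz
        obtain ⟨i, -, rfl⟩ := hz
        have := hK (t + 1) i ω
        omega
    -- Only an inequality, since an access discards the old contents altogether.
    have hold : (S.state A (t + 1) ω).out + (S.state A (t + 1) ω).cache ≤
        age ((S.state A t ω).out + (S.state A t ω).cache) + S.newContents (t + 1) ω := by
      simp only [state, step]
      split_ifs with h
      · simp
      · obtain ⟨h1, h2⟩ := hA.subset t ω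
        obtain ⟨Y, hY⟩ := Multiset.le_iff_exists_add.1 h1
        obtain ⟨Z, hZ⟩ := Multiset.le_iff_exists_add.1 h2
        simp only
        have e1 : (S.state A t ω).out + (A t ω).2 - (A t ω).1 = Y + (A t ω).2 := by
          rw [hY, add_assoc, add_tsub_cancel_left]
        have e2 : (S.state A t ω).cache + (A t ω).1 - (A t ω).2 = Z + (A t ω).1 := by
          rw [hZ, add_assoc, add_tsub_cancel_left]
        rw [e1, e2, hY, hZ]
        simp only [age_add]
        apply le_of_eq
        abel
    refine (Multiset.countP_le_of_le _ hold).trans ?_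
    rw [Multiset.countP_add]
    have h1 := countP_age_le j ((S.state A t ω).out + (S.state A t ω).cache)
    have h2 := ih (j + 1) (by omega)
    split_ifs at hnew with h
    · have : Kmax + 1 - j = Kmax + 1 - (j + 1) + 1 := by omega
      rw [this, Nat.mul_add]
      omega
    · have : Kmax + 1 - (j + 1) = Kmax + 1 - j := by omega
      rw [this] at h2
      omega

theorem pos_of_mem_newContents (hK : ∀ t i ω, 1 ≤ S.K t i ω) {t : ℕ} {ω : Ω} {z : ℕ}
    (hz : z ∈ S.newContents t ω) : 1 ≤ z := by
  simp only [newContents, Multiset.mem_map] at hz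
  obtain ⟨i, -, rfl⟩ := hz
  exact hK t i ω

theorem pos_of_mem_age {Z : Contents} {z : ℕ} (hz : z ∈ age Z) : 1 ≤ z :=
  (Multiset.mem_filter.1 hz).2

theorem pos_of_mem_remainder {A : Strategy Ω} {t : ℕ} {ω : Ω} {z : ℕ}
    (hz : z ∈ S.remainder A t ω) : 1 ≤ z := by
  unfold remainder at hz
  split_ifs at hz
  · simp at hz
  · exact pos_of_mem_age hz

theorem pos_of_mem_out (hK : ∀ t i ω, 1 ≤ S.K t i ω) {A : Strategy Ω} {t : ℕ} {ω : Ω} {z : ℕ}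
    (hz : z ∈ (S.state A t ω).out) : 1 ≤ z := by
  cases t with
  | zero => simp [state, initial] at hz
  | succ t =>
    rw [state_succ_out, Multiset.mem_add] at hz
    exact hz.elim S.pos_of_mem_remainder (S.pos_of_mem_newContents hK)

theorem card_out_le {Mmax Kmax : ℕ} (hM : ∀ t ω, S.M t ω ≤ Mmax)
    (hK : ∀ t i ω, 1 ≤ S.K t i ω ∧ S.K t i ω ≤ Kmax) {A : Strategy Ω} (hA : S.IsFeasible A)
    (t : ℕ) (ω : Ω) : (S.state A t ω).out.card ≤ Mmax * Kmax := by
  have h1 := S.countP_state_le hM (fun t i ω => (hK t i ω).2) hA t ω 1 le_rfl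
  rw [Multiset.countP_add, Nat.add_sub_cancel] at h1
  have h2 : (S.state A t ω).out.countP (fun z => 1 ≤ z) = (S.state A t ω).out.card :=
    Multiset.countP_eq_card.2 fun z hz => S.pos_of_mem_out (fun t i ω => (hK t i ω).1) hz
  omega

theorem card_remainder_le {Mmax Kmax : ℕ} (hM : ∀ t ω, S.M t ω ≤ Mmax)
    (hK : ∀ t i ω, 1 ≤ S.K t i ω ∧ S.K t i ω ≤ Kmax) {A : Strategy Ω} (hA : S.IsFeasible A)
    (t : ℕ) (ω : Ω) : (S.remainder A t ω).card ≤ Mmax * Kmax := by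
  have h := S.card_out_le hM hK hA (t + 1) ω
  rw [state_succ_out, Multiset.card_add] at h
  omega

theorem isFeasible_follow (τ : ℕ → ℕ → ℝ) : S.IsFeasible (S.follow (thresholdPolicy τ)) := by
  constructor
  · intro t ω
    rw [state_follow]
    unfold follow thresholdPolicy
    split_ifs
    · exact ⟨le_rfl, le_rfl⟩
    · exact ⟨Multiset.filter_le _ _, zero_le⟩
  · intro t ω h
    have h1 := S.state_elapsed (S.follow (thresholdPolicy τ)) t ω
    rw [(S.elapsed_eq_zero_iff t ω).2 h, state_follow] at h1
    rw [state_follow]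
    exact if_pos h1

/-- The least cost of serving the contents outside the cache in state `x` with channel cost `c`,
if a content that is left outside costs `w E L`. -/
def slotCost (w : ℕ → ℕ → ℝ) (x : State) (c : ℝ) : ℝ :=
  total (fun z => if x.elapsed = 0 then c else min c (w x.elapsed z)) x.out

/-- The pathwise Bellman inequality. In an access slot nothing remains and both sides are the price
of all contents outside; otherwise it is `total_min_le`, the shift `z - 1` coming from aging. -/
theorem slotCost_le {w : ℕ → ℕ → ℝ} (hw : ∀ e z, 0 ≤ w e z) (hw0 : ∀ e, w e 0 = 0)
    {A : Strategy Ω} (hA : S.IsFeasible A) (t : ℕ) (ω : Ω) (c : ℝ) :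
    slotCost (fun e z => w e (z - 1)) (S.state A t ω) c ≤
      (A t ω).1.card * c + total (w (S.elapsed t ω)) (S.remainder A t ω) := by
  unfold slotCost remainder
  rw [state_elapsed]
  by_cases h : S.IsAccess t ω
  · rw [if_pos h, hA.access t ω h]
    simp [(S.elapsed_eq_zero_iff t ω).2 h, total_const]
  · have h0 : S.elapsed t ω ≠ 0 := fun h0 => h ((S.elapsed_eq_zero_iff t ω).1 h0)
    rw [if_neg h, total_age (hw0 _)]
    simp only [h0, if_false]
    exact total_min_le (fun z => hw _ _) c (hA.subset t ω).1

/-- With the waiting cost itself as threshold, the Bellman inequality is an equality. -/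
theorem slotCost_follow {w : ℕ → ℕ → ℝ} (hw0 : ∀ e, w e 0 = 0) (t : ℕ) (ω : Ω) :
    ((S.follow (thresholdPolicy fun e z => w e (z - 1)) t ω).1.card : ℝ) * S.C t ω +
        total (w (S.elapsed t ω))
          (S.remainder (S.follow (thresholdPolicy fun e z => w e (z - 1))) t ω) =
      slotCost (fun e z => w e (z - 1))
        (S.state (S.follow (thresholdPolicy fun e z => w e (z - 1))) t ω) (S.C t ω) := by
  set A := S.follow (thresholdPolicy fun e z => w e (z - 1)) with hAdef
  have hA : S.IsFeasible A := S.isFeasible_follow _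
  unfold slotCost remainder
  rw [state_elapsed]
  by_cases h : S.IsAccess t ω
  · rw [if_pos h, hA.access t ω h]
    simp [(S.elapsed_eq_zero_iff t ω).2 h, total_const]
  · have h0 : S.elapsed t ω ≠ 0 := fun h0 => h ((S.elapsed_eq_zero_iff t ω).1 h0)
    rw [if_neg h, total_age (hw0 _)]
    simp only [h0, if_false]
    have h1 : A t ω = ((S.state A t ω).out.filter
        (fun z => S.C t ω ≤ w (S.elapsed t ω) (z - 1)), 0) := by
      have h2 := S.state_elapsed A t ω
      rw [hAdef, state_follow, follow, thresholdPolicy] at *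
      rw [if_neg (by rwa [h2])]
      simp only [h2]
    rw [h1]
    exact total_min_eq _ _ _

end System

/-! ### Discrete measurable structure on the countable types of contents and states -/

instance : MeasurableSpace Contents := ⊤
instance : DiscreteMeasurableSpace Contents := ⟨fun _ => trivial⟩
instance : MeasurableSpace State := ⊤
instance : DiscreteMeasurableSpace State := ⟨fun _ => trivial⟩
instance : Countable Contents := inferInstanceAs (Countable (Quotient (List.isSetoid ℕ)))
instance : Countable State :=
  Function.Injective.countable (f := fun x : State => (x.out, x.cache, x.elapsed)) (by
    rintro ⟨a, b, c⟩ ⟨a', b', c'⟩ h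
    simpa using h)

namespace System

variable {Ω : Type*} (S : System Ω)

/-! ### The dynamic program of a single content -/

section Values

variable [MeasurableSpace Ω] (P : Measure Ω)

/-- The conditional probability of an access in the next slot if the last one was `e` slots ago. -/
def hazard (e : ℕ) : ℝ := P.real {ω | S.D 0 ω = e + 1} / P.real {ω | e < S.D 0 ω}

/-- The expected cost, if the last access was `e` slots ago, of a content left outside the cache
in the present slot that is relevant for `L` further slots. -/
def waitingCost : ℕ → ℕ → ℝ
  | _, 0 => 0
  | e, L + 1 => S.hazard P e * ∫ ω, S.C 0 ω ∂P +
      (1 - S.hazard P e) * ∫ ω, min (S.C 0 ω) (waitingCost (e + 1) L) ∂P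

/-- The expected cost of a content outside the cache with remaining lifetime `z`, before the
channel cost is observed. -/
def contentCost (e z : ℕ) : ℝ :=
  if e = 0 then ∫ ω, S.C 0 ω ∂P else ∫ ω, min (S.C 0 ω) (S.waitingCost P e (z - 1)) ∂P

theorem waitingCost_zero (e : ℕ) : S.waitingCost P e 0 = 0 := rfl

/-- Waiting cost as an average over whether the next elapsed time is `0` or `e + 1`. The case `z =
0` is excluded because `contentCost P 0 0` is the mean price, whereas an expired content costs
nothing. -/
theorem waitingCost_of_pos (e : ℕ) {z : ℕ} (hz : 1 ≤ z) :
    S.waitingCost P e z = S.hazard P e * S.contentCost P 0 z +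
      (1 - S.hazard P e) * S.contentCost P (e + 1) z := by
  obtain ⟨L, rfl⟩ := Nat.exists_eq_add_of_le' hz
  simp [waitingCost, contentCost]

theorem hazard_nonneg (e : ℕ) : 0 ≤ S.hazard P e := div_nonneg measureReal_nonneg measureReal_nonneg

variable [IsProbabilityMeasure P]

theorem hazard_le_one (e : ℕ) : S.hazard P e ≤ 1 := by
  refine div_le_one_of_le₀ (measureReal_mono fun ω h => ?_) measureReal_nonneg
  have : S.D 0 ω = e + 1 := h
  simp [this]

variable {P S} {Cmax : ℝ} {Mmax Kmax Dmax : ℕ} (hS : S.IsModel P Cmax Mmax Kmax Dmax)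
include hS

theorem IsModel.integrable_min (w : ℝ) : Integrable (fun ω => min (S.C 0 ω) w) P := by
  refine Integrable.of_bound (C := Cmax + |w|)
    ((hS.measurable_C 0).min measurable_const).aestronglyMeasurable (ae_of_all _ fun ω => ?_)
  have h := hS.C_mem 0 ω
  rw [Real.norm_eq_abs, abs_le]
  refine ⟨le_min ?_ ?_, (min_le_left _ _).trans ?_⟩ <;>
    linarith [abs_nonneg w, neg_abs_le w]

theorem IsModel.integrable_C (t : ℕ) : Integrable (S.C t) P := by
  refine Integrable.of_bound (C := Cmax) (hS.measurable_C t).aestronglyMeasurable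
    (ae_of_all _ fun ω => ?_)
  have h := hS.C_mem t ω
  rw [Real.norm_eq_abs, abs_of_nonneg h.1]
  exact h.2

theorem IsModel.Cmax_nonneg : 0 ≤ Cmax := by
  obtain ⟨ω⟩ := nonempty_of_isProbabilityMeasure P
  exact (hS.C_mem 0 ω).1.trans (hS.C_mem 0 ω).2

theorem IsModel.integral_C_mem : 0 ≤ ∫ ω, S.C 0 ω ∂P ∧ ∫ ω, S.C 0 ω ∂P ≤ Cmax := by
  refine ⟨integral_nonneg fun ω => (hS.C_mem 0 ω).1, ?_⟩
  simpa using integral_mono (hS.integrable_C 0) (integrable_const Cmax) fun ω => (hS.C_mem 0 ω).2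

theorem IsModel.integral_min_mem {w : ℝ} (hw : 0 ≤ w) :
    0 ≤ ∫ ω, min (S.C 0 ω) w ∂P ∧ ∫ ω, min (S.C 0 ω) w ∂P ≤ ∫ ω, S.C 0 ω ∂P :=
  ⟨integral_nonneg fun ω => le_min (hS.C_mem 0 ω).1 hw,
    integral_mono (hS.integrable_min w) (hS.integrable_C 0) fun _ => min_le_left _ _⟩

/-- The upper bound is a convex combination: waiting costs the mean price upon an access, and at
most that otherwise, since one may buy in the next slot. -/
theorem IsModel.waitingCost_mem (e L : ℕ) :
    0 ≤ S.waitingCost P e L ∧ S.waitingCost P e L ≤ ∫ ω, S.C 0 ω ∂P := by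
  induction L generalizing e with
  | zero => exact ⟨le_rfl, hS.integral_C_mem.1⟩
  | succ L ih =>
    have h1 := S.hazard_nonneg P e
    have h2 := S.hazard_le_one P e
    have h3 := hS.integral_min_mem (ih (e + 1)).1
    have h4 := hS.integral_C_mem
    rw [waitingCost]
    constructor
    · exact add_nonneg (mul_nonneg h1 h4.1) (mul_nonneg (by linarith) h3.1)
    · nlinarith [mul_le_mul_of_nonneg_left h3.2 (sub_nonneg.2 h2)]

/-- The recursion is monotone in the continuation value, and its start at `L = 0` is the least
possible value `0`. The induction needs all `e` at once because the recursion moves to `e + 1`. -/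
theorem IsModel.monotone_waitingCost (e : ℕ) : Monotone (S.waitingCost P e) := by
  refine monotone_nat_of_le_succ fun L => ?_
  induction L generalizing e with
  | zero => exact (hS.waitingCost_mem e 1).1
  | succ L ih =>
    have h2 := S.hazard_le_one P e
    rw [waitingCost, waitingCost]
    refine add_le_add_right (mul_le_mul_of_nonneg_left ?_ (sub_nonneg.2 h2)) _
    exact integral_mono (hS.integrable_min _) (hS.integrable_min _)
      fun ω => min_le_min le_rfl (ih _)

theorem IsModel.contentCost_mem (e z : ℕ) :
    0 ≤ S.contentCost P e z ∧ S.contentCost P e z ≤ Cmax := by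
  unfold contentCost
  have h1 := hS.integral_C_mem
  have h2 := hS.integral_min_mem (hS.waitingCost_mem e (z - 1)).1
  split_ifs
  · exact h1
  · exact ⟨h2.1, h2.2.trans h1.2⟩

/-- The inner integral for Fubini: with the state frozen, averaging over the price acts on each
content separately. -/
theorem IsModel.integral_slotCost (x : State) :
    Integrable (fun ω => slotCost (fun e z => S.waitingCost P e (z - 1)) x (S.C 0 ω)) P ∧
    ∫ ω, slotCost (fun e z => S.waitingCost P e (z - 1)) x (S.C 0 ω) ∂P =
      total (S.contentCost P x.elapsed) x.out := by
  obtain ⟨O, I, e⟩ := x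
  simp only [slotCost]
  induction O using Multiset.induction with
  | empty => simp
  | cons a O ih =>
    have h1 : Integrable (fun ω => if e = 0 then S.C 0 ω else
        min (S.C 0 ω) (S.waitingCost P e (a - 1))) P := by
      split_ifs
      · exact hS.integrable_C 0
      · exact hS.integrable_min _
    simp only [total_cons]
    refine ⟨h1.add ih.1, ?_⟩
    rw [integral_add h1 ih.1, ih.2]
    congr 1
    unfold contentCost
    split_ifs <;> rfl

end Values

/-! ### Measurability of the state and the actions for an arbitrary σ-algebra -/

section Measurability

variable {m : MeasurableSpace Ω} {S}

theorem measurable_newContents {t : ℕ} (hM : Measurable (S.M t))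
    (hK : ∀ i, Measurable (S.K t i)) : Measurable (S.newContents t) := by
  have h : ∀ n, Measurable fun ω => ((Multiset.range n).map (fun i => S.K t i ω) : Contents) := by
    intro n
    induction n with
    | zero => simp
    | succ n ih =>
      simp only [Multiset.range_succ, Multiset.map_cons]
      exact (Measurable.of_discrete (f := fun p : ℕ × Contents => (p.1 ::ₘ p.2 : Contents))).comp
        ((hK n).prodMk ih)
  -- The number of new contents is random: each fixed number was treated above, and countably many
  -- values are glued together.
  exact (measurable_from_prod_countable_right
    (f := fun p : ℕ × Ω => ((Multiset.range p.1).map (fun i => S.K t i p.2) : Contents)) h).comp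
    (hM.prodMk measurable_id)

theorem measurable_accessTime {n : ℕ} (hD : ∀ k < n, Measurable (S.D k)) :
    Measurable (S.accessTime n) := by
  unfold accessTime
  exact Finset.measurable_fun_sum _ fun k hk => hD k (Finset.mem_range.1 hk)

theorem measurable_isAccess (hD : ∀ k, Measurable (S.D k)) (t : ℕ) :
    Measurable (S.IsAccess t) := by
  refine measurableSet_setOfPred.1 ?_
  have : {ω | S.IsAccess t ω} = ⋃ n, {ω | S.accessTime n ω = t} := by
    ext ω; simp [IsAccess, accessTime]
  rw [this]
  exact MeasurableSet.iUnion fun n =>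
    measurable_accessTime (fun k _ => hD k) (measurableSet_singleton t)

theorem measurable_elapsed {t : ℕ} (h : ∀ s ≤ t, Measurable (S.IsAccess s)) :
    Measurable (S.elapsed t) := by
  classical
  induction t with
  | zero =>
    have : S.elapsed 0 = fun _ => 0 := by
      funext ω; exact (S.elapsed_eq_zero_iff 0 ω).2 (S.isAccess_zero ω)
    rw [this]; exact measurable_const
  | succ t ih =>
    have : S.elapsed (t + 1) = fun ω => if S.IsAccess (t + 1) ω then 0 else S.elapsed t ω + 1 :=
      funext fun ω => S.elapsed_succ t ω
    rw [this]
    exact Measurable.ite (measurableSet_setOfPred.2 (h _ le_rfl)) measurable_const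
      ((ih fun s hs => h s (by omega)).add_const 1)

/-- Only actions of slots before `t` enter. With the σ-algebra left free, this serves both for
measurability with respect to the history and for independence of the state from the price of slot
`t`. -/
theorem measurable_state {A : Strategy Ω} {t : ℕ} (hA : ∀ s < t, Measurable (A s))
    (hN : ∀ s ≤ t, Measurable (S.newContents s)) (hU : ∀ s ≤ t, Measurable (S.IsAccess s)) :
    Measurable (S.state A t) := by
  classical
  induction t with
  | zero =>
    exact (Measurable.of_discrete (f := fun e : ℕ => (⟨0, 0, e⟩ : State))).comp
      (measurable_elapsed hU)
  | succ t ih =>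
    have h := ih (fun s hs => hA s (by omega)) (fun s hs => hN s (by omega))
      (fun s hs => hU s (by omega))
    have e1 := measurable_elapsed hU
    have h1 : Measurable fun ω => (⟨S.newContents (t + 1) ω, 0, S.elapsed (t + 1) ω⟩ : State) :=
      (Measurable.of_discrete (f := fun p : Contents × ℕ => (⟨p.1, 0, p.2⟩ : State))).comp
        ((hN _ le_rfl).prodMk e1)
    have h2 : Measurable fun ω => (⟨age ((S.state A t ω).out + (A t ω).2 - (A t ω).1) +
        S.newContents (t + 1) ω, age ((S.state A t ω).cache + (A t ω).1 - (A t ω).2),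
        S.elapsed (t + 1) ω⟩ : State) :=
      (Measurable.of_discrete (f := fun p : (State × Action) × Contents × ℕ =>
        (⟨age (p.1.1.out + p.1.2.2 - p.1.2.1) + p.2.1, age (p.1.1.cache + p.1.2.1 - p.1.2.2),
          p.2.2⟩ : State))).comp
        ((h.prodMk (hA t (by omega))).prodMk ((hN _ le_rfl).prodMk e1))
    have h3 : S.state A (t + 1) = fun ω => if S.IsAccess t ω then
        (⟨S.newContents (t + 1) ω, 0, S.elapsed (t + 1) ω⟩ : State) else
        ⟨age ((S.state A t ω).out + (A t ω).2 - (A t ω).1) +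
        S.newContents (t + 1) ω, age ((S.state A t ω).cache + (A t ω).1 - (A t ω).2),
        S.elapsed (t + 1) ω⟩ := by
      funext ω
      simp only [state, step]
    rw [h3]
    exact Measurable.ite (measurableSet_setOfPred.2 (hU _ (by omega))) h1 h2

theorem measurable_remainder {A : Strategy Ω} {t : ℕ} (hA : ∀ s ≤ t, Measurable (A s))
    (hN : ∀ s ≤ t, Measurable (S.newContents s)) (hU : ∀ s ≤ t, Measurable (S.IsAccess s)) :
    Measurable (S.remainder A t) := by
  unfold remainder
  refine Measurable.ite (measurableSet_setOfPred.2 (hU _ le_rfl)) measurable_const ?_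
  exact (Measurable.of_discrete (f := fun p : State × Action =>
    (age (p.1.out + p.2.2 - p.2.1)))).comp
    ((measurable_state (fun s hs => hA s hs.le) hN hU).prodMk (hA t le_rfl))

theorem measurable_thresholdPolicy (τ : ℕ → ℕ → ℝ) :
    Measurable fun p : State × ℝ => thresholdPolicy τ p.1 p.2 := by
  refine measurable_from_prod_countable_right fun x => ?_
  by_cases hx : x.elapsed = 0 <;> simp only [thresholdPolicy, hx, if_true, if_false]
  · exact measurable_const
  · refine Measurable.prodMk ?_ measurable_const
    induction x.out using Multiset.induction with
    | empty => simp
    | cons a O ih =>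
      simp only [Multiset.filter_cons]
      exact (Measurable.of_discrete (f := fun p : Contents × Contents => p.1 + p.2)).comp
        ((Measurable.ite measurableSet_Iic measurable_const measurable_const).prodMk ih)

theorem measurable_follow (τ : ℕ → ℕ → ℝ) {t : ℕ} (hC : ∀ s ≤ t, Measurable (S.C s))
    (hN : ∀ s ≤ t, Measurable (S.newContents s)) (hU : ∀ s ≤ t, Measurable (S.IsAccess s)) :
    Measurable (S.follow (thresholdPolicy τ) t) := by
  induction t using Nat.strong_induction_on with
  | _ t ih =>
    have h := measurable_state (S := S) (A := S.follow (thresholdPolicy τ)) (t := t)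
      (fun s hs => ih s hs (fun r hr => hC r (by omega)) (fun r hr => hN r (by omega))
        (fun r hr => hU r (by omega))) hN hU
    have h1 : S.follow (thresholdPolicy τ) t = fun ω =>
        thresholdPolicy τ (S.state (S.follow (thresholdPolicy τ)) t ω) (S.C t ω) := by
      funext ω; rw [state_follow]; rfl
    rw [h1]
    exact (measurable_thresholdPolicy τ).comp (h.prodMk (hC t le_rfl))

end Measurability

end System

/-! ### Independence of one price, or of one gap, from everything else -/

/-- On the π-system of intersections `a ∩ b`, peel off `a` and then `b`: the probability of `a ∩ b ∩
c` factors completely, and the first two factors recombine. -/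
theorem indep_sup_left_of_indep {Ω : Type*} {m₁ m₂ m₃ mΩ : MeasurableSpace Ω} {P : Measure Ω}
    [IsProbabilityMeasure P] (h₁ : m₁ ≤ mΩ) (h₂ : m₂ ≤ mΩ) (h₃ : m₃ ≤ mΩ)
    (h : Indep m₁ (m₂ ⊔ m₃) P) (h' : Indep m₂ m₃ P) : Indep (m₁ ⊔ m₂) m₃ P := by
  let p : Set (Set Ω) := {s | ∃ a b, MeasurableSet[m₁] a ∧ MeasurableSet[m₂] b ∧ s = a ∩ b}
  have hp : m₁ ⊔ m₂ = MeasurableSpace.generateFrom p := by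
    refine le_antisymm (sup_le (fun a ha => ?_) fun b hb => ?_)
      (MeasurableSpace.generateFrom_le ?_)
    · exact MeasurableSpace.measurableSet_generateFrom
        ⟨a, Set.univ, ha, MeasurableSet.univ, (Set.inter_univ a).symm⟩
    · exact MeasurableSpace.measurableSet_generateFrom
        ⟨Set.univ, b, MeasurableSet.univ, hb, (Set.univ_inter b).symm⟩
    · rintro _ ⟨a, b, ha, hb, rfl⟩
      exact (le_sup_left (a := m₁) (b := m₂) a ha).inter (le_sup_right (a := m₁) (b := m₂) b hb)
  have hpi : IsPiSystem p := by
    rintro _ ⟨a, b, ha, hb, rfl⟩ _ ⟨a', b', ha', hb', rfl⟩ -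
    exact ⟨a ∩ a', b ∩ b', ha.inter ha', hb.inter hb', Set.inter_inter_inter_comm a b a' b'⟩
  refine IndepSets.indep (sup_le h₁ h₂) h₃ hpi (@MeasurableSpace.isPiSystem_measurableSet Ω m₃) hp
    (@MeasurableSpace.generateFrom_measurableSet Ω m₃).symm ?_
  rw [IndepSets_iff]
  rintro _ c ⟨a, b, ha, hb, rfl⟩ hc
  have hb' := le_sup_left (a := m₂) (b := m₃) b hb
  have hc' := le_sup_right (a := m₂) (b := m₃) c hc
  rw [Indep_iff] at h h'
  rw [Set.inter_assoc, h a _ ha (hb'.inter hc'), h' b c hb hc, h a b ha hb', mul_assoc]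

namespace System

variable {Ω : Type*} (S : System Ω)

/-- The σ-algebra of the channel costs. -/
@[reducible] def costs : MeasurableSpace Ω := ⨆ t, MeasurableSpace.comap (S.C t) inferInstance

/-- The σ-algebra of the numbers of new contents. -/
@[reducible] def numbers : MeasurableSpace Ω := ⨆ t, MeasurableSpace.comap (S.M t) ⊤

/-- The σ-algebra of the lifetimes. -/
@[reducible] def lifetimes : MeasurableSpace Ω := ⨆ t, ⨆ i, MeasurableSpace.comap (S.K t i) ⊤

/-- The σ-algebra of the inter-access times. -/
@[reducible] def gaps : MeasurableSpace Ω := ⨆ n, MeasurableSpace.comap (S.D n) ⊤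

theorem measurable_of_comap_le {β : Type*} {m : MeasurableSpace Ω} {mβ : MeasurableSpace β}
    {f : Ω → β} (h : MeasurableSpace.comap f mβ ≤ m) : Measurable f :=
  measurable_iff_comap_le.2 h

theorem measurable_newContents_of_le {m : MeasurableSpace Ω} (hM : S.numbers ≤ m)
    (hK : S.lifetimes ≤ m) (t : ℕ) : Measurable (S.newContents t) :=
  measurable_newContents
    (measurable_of_comap_le ((le_iSup (fun t => MeasurableSpace.comap (S.M t) ⊤) t).trans hM))
    fun i => measurable_of_comap_le ((le_iSup₂
      (f := fun t i => MeasurableSpace.comap (S.K t i) ⊤) t i).trans hK)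

theorem measurable_isAccess_of_le {m : MeasurableSpace Ω} (hD : S.gaps ≤ m) (t : ℕ) :
    Measurable (S.IsAccess t) :=
  measurable_isAccess
    (fun n => measurable_of_comap_le ((le_iSup (fun n => MeasurableSpace.comap (S.D n) ⊤) n).trans
      hD)) t

theorem measurable_C_history {s t : ℕ} (h : s ≤ t) : Measurable[S.history t] (S.C s) :=
  measurable_of_comap_le ((le_sup_left.trans le_sup_left).trans (le_iSup₂
    (f := fun s (_ : s ≤ t) => MeasurableSpace.comap (S.C s) inferInstance ⊔
      MeasurableSpace.comap (S.newContents s) ⊤ ⊔ MeasurableSpace.comap (S.IsAccess s) ⊤) s h))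

theorem measurable_newContents_history {s t : ℕ} (h : s ≤ t) :
    Measurable[S.history t] (S.newContents s) :=
  measurable_of_comap_le ((le_sup_right.trans le_sup_left).trans (le_iSup₂
    (f := fun s (_ : s ≤ t) => MeasurableSpace.comap (S.C s) inferInstance ⊔
      MeasurableSpace.comap (S.newContents s) ⊤ ⊔ MeasurableSpace.comap (S.IsAccess s) ⊤) s h))

theorem measurable_isAccess_history {s t : ℕ} (h : s ≤ t) :
    Measurable[S.history t] (S.IsAccess s) :=
  measurable_of_comap_le (le_sup_right.trans (le_iSup₂
    (f := fun s (_ : s ≤ t) => MeasurableSpace.comap (S.C s) inferInstance ⊔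
      MeasurableSpace.comap (S.newContents s) ⊤ ⊔ MeasurableSpace.comap (S.IsAccess s) ⊤) s h))

theorem history_le {m : MeasurableSpace Ω} {t : ℕ} (hC : ∀ s ≤ t, Measurable (S.C s))
    (hN : ∀ s ≤ t, Measurable (S.newContents s)) (hU : ∀ s ≤ t, Measurable (S.IsAccess s)) :
    S.history t ≤ m :=
  iSup₂_le fun s hs => sup_le (sup_le (hC s hs).comap_le (hN s hs).comap_le) (hU s hs).comap_le

theorem history_mono {s t : ℕ} (h : s ≤ t) : S.history s ≤ S.history t :=
  S.history_le (fun _ hr => S.measurable_C_history (hr.trans h))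
    (fun _ hr => S.measurable_newContents_history (hr.trans h))
    fun _ hr => S.measurable_isAccess_history (hr.trans h)

/-- The σ-algebra of all the sequences and of the randomization `𝒢`, without the `n`-th
inter-access time. -/
@[reducible] def withoutGap (𝒢 : MeasurableSpace Ω) (n : ℕ) : MeasurableSpace Ω :=
  𝒢 ⊔ (S.costs ⊔ S.numbers ⊔ S.lifetimes) ⊔
    ⨆ k ∈ ({n}ᶜ : Set ℕ), MeasurableSpace.comap (S.D k) ⊤

section Independence

variable {S} {𝒢 : MeasurableSpace Ω} [mΩ : MeasurableSpace Ω] {P : Measure Ω}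
  {Cmax : ℝ} {Mmax Kmax Dmax : ℕ} (hS : S.IsModel P Cmax Mmax Kmax Dmax)
include hS

theorem IsModel.costs_le : S.costs ≤ mΩ := iSup_le fun t => (hS.measurable_C t).comap_le
theorem IsModel.numbers_le : S.numbers ≤ mΩ := iSup_le fun t => (hS.measurable_M t).comap_le
theorem IsModel.lifetimes_le : S.lifetimes ≤ mΩ :=
  iSup₂_le fun t i => (hS.measurable_K t i).comap_le
theorem IsModel.gaps_le : S.gaps ≤ mΩ := iSup_le fun t => (hS.measurable_D t).comap_le

theorem IsModel.history_le (t : ℕ) : S.history t ≤ mΩ :=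
  S.history_le (fun s _ => hS.measurable_C s)
    (fun s _ => S.measurable_newContents_of_le hS.numbers_le hS.lifetimes_le s)
    (fun s _ => measurable_isAccess hS.measurable_D s)

/-- On the event `lastAccess t (n, e)` the past up to slot `t` does not involve the `n`-th
inter-access time. -/
theorem IsModel.exists_inter_lastAccess_eq {t n e : ℕ} {G : Set Ω}
    (hG : MeasurableSet[𝒢 ⊔ S.history t] G) :
    ∃ G', MeasurableSet[S.withoutGap 𝒢 n] G' ∧
      G ∩ S.lastAccess t (n, e) = G' ∩ S.lastAccess t (n, e) := by
  -- Pulling back along the inclusion of the event and pushing forward again gives the σ-algebra of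
  -- all sets whose trace on the event is the trace of a set in `withoutGap`. It therefore suffices
  -- to check the generators of the past.
  let v : S.lastAccess t (n, e) → Ω := Subtype.val
  have hle : (S.withoutGap 𝒢 n) ≤ ((S.withoutGap 𝒢 n).comap v).map v := MeasurableSpace.le_map_comap
  have h1 : S.costs ⊔ S.numbers ⊔ S.lifetimes ≤ (S.withoutGap 𝒢 n) := le_sup_right.trans le_sup_left
  have hD : ∀ k < n, Measurable[S.withoutGap 𝒢 n] (S.D k) := fun k hk =>
    measurable_of_comap_le ((le_iSup₂ (f := fun k (_ : k ∈ ({n}ᶜ : Set ℕ)) =>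
      MeasurableSpace.comap (S.D k) ⊤) k (by simpa using hk.ne)).trans le_sup_right)
  have key : 𝒢 ⊔ S.history t ≤ ((S.withoutGap 𝒢 n).comap v).map v := by
    refine sup_le ((le_sup_left.trans le_sup_left).trans hle) (S.history_le ?_ ?_ ?_)
    · intro s _
      exact measurable_of_comap_le (((le_iSup (fun t => MeasurableSpace.comap (S.C t) _) s).trans
        ((le_sup_left.trans le_sup_left).trans h1)).trans hle)
    · intro s _
      exact S.measurable_newContents_of_le (m := ((S.withoutGap 𝒢 n).comap v).map v) ((le_sup_right.trans le_sup_left).trans (h1.trans hle))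
        (le_sup_right.trans (h1.trans hle)) s
    · intro s hs
      refine (@measurableSet_setOfPred _ (((S.withoutGap 𝒢 n).comap v).map v) _).1 ?_
      -- Access times with index at most `n` involve only gaps of index below `n`.
      refine ⟨⋃ m ∈ Set.Iic n, {ω | S.accessTime m ω = s}, ?_, ?_⟩
      · refine MeasurableSet.biUnion (Set.to_countable _) fun m hm => ?_
        exact measurable_accessTime (m := (S.withoutGap 𝒢 n)) (fun k hk => hD k (hk.trans_le hm)) (measurableSet_singleton s)
      · ext ⟨ω, hω⟩
        have := S.isAccess_iff_of_mem_lastAccess (fun n => (hS.D_mem n ω).1) hω hs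
        simp only [Set.mem_preimage, Set.mem_iUnion, Set.mem_ofPred_eq, v, this, Set.mem_Iic,
          exists_prop]
  obtain ⟨G', hG', h⟩ := key G hG
  refine ⟨G', hG', ?_⟩
  ext ω
  constructor
  · rintro ⟨h2, h3⟩
    exact ⟨(Set.ext_iff.1 h ⟨ω, h3⟩).2 h2, h3⟩
  · rintro ⟨h2, h3⟩
    exact ⟨(Set.ext_iff.1 h ⟨ω, h3⟩).1 h2, h3⟩

variable [IsProbabilityMeasure P]

/-- The channel cost of slot `t` is independent of everything else. -/
theorem IsModel.indep_C_rest (h𝒢 : 𝒢 ≤ mΩ) (hind : Indep 𝒢 S.noise P) (t : ℕ) :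
    Indep (𝒢 ⊔ (S.numbers ⊔ S.lifetimes ⊔ S.gaps) ⊔
      ⨆ s ∈ ({t}ᶜ : Set ℕ), MeasurableSpace.comap (S.C s) inferInstance)
      (MeasurableSpace.comap (S.C t) inferInstance) P := by
  have hle : S.numbers ⊔ S.lifetimes ⊔ S.gaps ≤ mΩ :=
    sup_le (sup_le hS.numbers_le hS.lifetimes_le) hS.gaps_le
  have h1 : Indep (S.numbers ⊔ S.lifetimes ⊔ S.gaps) S.costs P := by
    have h := indep_iSup_of_disjoint (fun i : Fin 4 => by
      fin_cases i
      · exact hS.costs_le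
      · exact hS.numbers_le
      · exact hS.lifetimes_le
      · exact hS.gaps_le) hS.indep (S := {1, 2, 3}) (T := {0}) (by simp)
    refine indep_of_indep_of_le h (sup_le (sup_le ?_ ?_) ?_) ?_
    · exact le_iSup₂_of_le (1 : Fin 4) (by simp) le_rfl
    · exact le_iSup₂_of_le (2 : Fin 4) (by simp) le_rfl
    · exact le_iSup₂_of_le (3 : Fin 4) (by simp) le_rfl
    · exact le_iSup₂_of_le (0 : Fin 4) (by simp) le_rfl
  have h2 : Indep (𝒢 ⊔ (S.numbers ⊔ S.lifetimes ⊔ S.gaps)) S.costs P := by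
    refine indep_sup_left_of_indep h𝒢 hle hS.costs_le (indep_of_indep_of_le_right hind ?_) h1
    refine sup_le (sup_le (sup_le ?_ ?_) ?_) ?_
    · exact le_sup_right.trans (le_sup_left.trans le_sup_left)
    · exact le_sup_right.trans le_sup_left
    · exact le_sup_right
    · exact le_sup_left.trans (le_sup_left.trans le_sup_left)
  refine indep_sup_left_of_indep (sup_le h𝒢 hle) (iSup₂_le fun s _ => (hS.measurable_C s).comap_le)
    (hS.measurable_C t).comap_le (indep_of_indep_of_le_right h2 ?_) ?_
  · exact sup_le (iSup₂_le fun s _ => le_iSup (fun t => MeasurableSpace.comap (S.C t) _) s)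
      (le_iSup (fun t => MeasurableSpace.comap (S.C t) _) t)
  · have h := indep_iSup_of_disjoint (fun t => (hS.measurable_C t).comap_le) hS.indep_C
      (S := {t}ᶜ) (T := {t}) (by simp [disjoint_compl_left])
    exact indep_of_indep_of_le_right h (le_iSup₂_of_le _ rfl le_rfl)

/-- The `n`-th inter-access time is independent of everything else. -/
theorem IsModel.indep_D_rest (h𝒢 : 𝒢 ≤ mΩ) (hind : Indep 𝒢 S.noise P) (n : ℕ) :
    Indep (S.withoutGap 𝒢 n) (MeasurableSpace.comap (S.D n) ⊤) P := by
  have hle : S.costs ⊔ S.numbers ⊔ S.lifetimes ≤ mΩ :=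
    sup_le (sup_le hS.costs_le hS.numbers_le) hS.lifetimes_le
  have h1 : Indep (S.costs ⊔ S.numbers ⊔ S.lifetimes) S.gaps P := by
    have h := indep_iSup_of_disjoint (fun i : Fin 4 => by
      fin_cases i
      · exact hS.costs_le
      · exact hS.numbers_le
      · exact hS.lifetimes_le
      · exact hS.gaps_le) hS.indep (S := {0, 1, 2}) (T := {3}) (by simp)
    refine indep_of_indep_of_le h (sup_le (sup_le ?_ ?_) ?_) ?_
    · exact le_iSup₂_of_le (0 : Fin 4) (by simp) le_rfl
    · exact le_iSup₂_of_le (1 : Fin 4) (by simp) le_rfl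
    · exact le_iSup₂_of_le (2 : Fin 4) (by simp) le_rfl
    · exact le_iSup₂_of_le (3 : Fin 4) (by simp) le_rfl
  have h2 : Indep (𝒢 ⊔ (S.costs ⊔ S.numbers ⊔ S.lifetimes)) S.gaps P :=
    indep_sup_left_of_indep h𝒢 hle hS.gaps_le hind h1
  refine indep_sup_left_of_indep (sup_le h𝒢 hle) (iSup₂_le fun s _ => (hS.measurable_D s).comap_le)
    (hS.measurable_D n).comap_le (indep_of_indep_of_le_right h2 ?_) ?_
  · exact sup_le (iSup₂_le fun s _ => le_iSup (fun t => MeasurableSpace.comap (S.D t) _) s)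
      (le_iSup (fun t => MeasurableSpace.comap (S.D t) _) n)
  · have h := indep_iSup_of_disjoint (fun t => (hS.measurable_D t).comap_le) hS.indep_D
      (S := {n}ᶜ) (T := {n}) (by simp [disjoint_compl_left])
    exact indep_of_indep_of_le_right h (le_iSup₂_of_le _ rfl le_rfl)

/-- On this event the past restricts the `n`-th gap only by `e < D n`, and an access follows iff `D
n = e + 1`. As that gap is independent of the rest, the ratio of the two probabilities is the
hazard. -/
theorem IsModel.measureReal_isAccess_inter (h𝒢 : 𝒢 ≤ mΩ) (hind : Indep 𝒢 S.noise P) {t n e : ℕ}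
    {G : Set Ω} (hG : MeasurableSet[𝒢 ⊔ S.history t] G) :
    P.real ((G ∩ S.lastAccess t (n, e)) ∩ {ω | S.IsAccess (t + 1) ω}) =
      S.hazard P e * P.real (G ∩ S.lastAccess t (n, e)) := by
  obtain ⟨G', hG', h⟩ := hS.exists_inter_lastAccess_eq (n := n) (e := e) hG
  have hI := hS.indep_D_rest h𝒢 hind n
  rw [Indep_iff] at hI
  have hT : MeasurableSet[S.withoutGap 𝒢 n] (G' ∩ {ω | S.accessTime n ω + e = t}) := by
    refine hG'.inter ?_
    have hD : ∀ k < n, Measurable[S.withoutGap 𝒢 n] (S.D k) := fun k hk =>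
      measurable_of_comap_le ((le_iSup₂ (f := fun k (_ : k ∈ ({n}ᶜ : Set ℕ)) =>
        MeasurableSpace.comap (S.D k) ⊤) k (by simpa using hk.ne)).trans le_sup_right)
    exact ((measurable_accessTime (m := (S.withoutGap 𝒢 n)) hD).add_const e) (measurableSet_singleton t)
  have hDn : ∀ s : Set ℕ, P (S.D n ⁻¹' s) = P (S.D 0 ⁻¹' s) := fun s =>
    (hS.ident_D n).measure_preimage_eq (MeasurableSet.of_discrete)
  have e1 : G ∩ S.lastAccess t (n, e) =
      (G' ∩ {ω | S.accessTime n ω + e = t}) ∩ S.D n ⁻¹' {d | e < d} := by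
    rw [h]
    ext ω
    simp [lastAccess, and_assoc]
  have e2 : (G ∩ S.lastAccess t (n, e)) ∩ {ω | S.IsAccess (t + 1) ω} =
      (G' ∩ {ω | S.accessTime n ω + e = t}) ∩ S.D n ⁻¹' {d | d = e + 1} := by
    rw [h]
    ext ω
    constructor
    · rintro ⟨⟨h1, h2⟩, h3⟩
      exact ⟨⟨h1, h2.1⟩,
        (S.isAccess_succ_iff_of_mem_lastAccess (fun n => (hS.D_mem n ω).1) h2).1 h3⟩
    · rintro ⟨⟨h1, h2⟩, h3⟩
      have h3 : S.D n ω = e + 1 := h3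
      have h4 : ω ∈ S.lastAccess t (n, e) := ⟨h2, by simp [h3]⟩
      exact ⟨⟨h1, h4⟩,
        (S.isAccess_succ_iff_of_mem_lastAccess (fun n => (hS.D_mem n ω).1) h4).2 h3⟩
  have h1 := hI _ (S.D n ⁻¹' {d | e < d}) hT ⟨_, trivial, rfl⟩
  have h2 := hI _ (S.D n ⁻¹' {d | d = e + 1}) hT ⟨_, trivial, rfl⟩
  rw [hDn] at h1 h2
  rw [e2, e1, measureReal_def, measureReal_def, h1, h2, ENNReal.toReal_mul, ENNReal.toReal_mul]
  change _ * P.real {ω | S.D 0 ω = e + 1} = _ * (_ * P.real {ω | e < S.D 0 ω})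
  unfold hazard
  -- If gaps longer than `e` have probability zero, the hazard is `0 / 0 = 0` by convention, and
  -- both sides vanish.
  rcases eq_or_ne (P.real {ω | e < S.D 0 ω}) 0 with h0 | h0
  · have : P.real {ω | S.D 0 ω = e + 1} ≤ P.real {ω | e < S.D 0 ω} :=
      measureReal_mono fun ω h => by
        have : S.D 0 ω = e + 1 := h
        simp [this]
    have : P.real {ω | S.D 0 ω = e + 1} = 0 := le_antisymm (this.trans h0.le) measureReal_nonneg
    rw [this, h0]; simp
  · field_simp

end Independence

end System

/-! ### The hazard as conditional probability of an access -/

/-- The hypothesis `h` identifies `g` as the conditional probability of `U` given `m`; the bounded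
`m`-measurable factor `Y` is pulled out of the conditional expectation. -/
theorem integral_indicator_eq_integral_mul {Ω : Type*} {m mΩ : MeasurableSpace Ω} (hm : m ≤ mΩ)
    {P : Measure Ω} [IsProbabilityMeasure P] {U : Set Ω} (hU : MeasurableSet U) {g Y : Ω → ℝ}
    (hg : Measurable[m] g) (hgi : Integrable g P) (hY : Measurable[m] Y) {b : ℝ}
    (hb : ∀ ω, |Y ω| ≤ b)
    (h : ∀ G, MeasurableSet[m] G → ∫ ω in G, g ω ∂P = ∫ ω in G, U.indicator (fun _ => 1) ω ∂P) :
    ∫ ω, U.indicator Y ω ∂P = ∫ ω, Y ω * g ω ∂P := by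
  have hi : Integrable (U.indicator (fun _ => (1 : ℝ))) P := (integrable_const 1).indicator hU
  have h1 : g =ᵐ[P] P[U.indicator (fun _ => (1 : ℝ)) | m] :=
    ae_eq_condExp_of_forall_setIntegral_eq hm hi (fun s _ _ => hgi.integrableOn)
      (fun s hs _ => h s hs) hg.stronglyMeasurable.aestronglyMeasurable
  have h2 := condExp_stronglyMeasurable_mul_of_bound hm hY.stronglyMeasurable hi b
    (ae_of_all P fun ω => by simpa using hb ω)
  have h3 : U.indicator Y = Y * U.indicator (fun _ => (1 : ℝ)) := by
    ext ω
    by_cases hω : ω ∈ U <;> simp [hω]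
  rw [h3, ← integral_condExp hm]
  refine integral_congr_ae ?_
  filter_upwards [h1, h2] with ω h1 h2
  rw [h2, Pi.mul_apply, h1]

theorem total_linear (a b : ℝ) (f g : ℕ → ℝ) (Z : Contents) :
    total (fun z => a * f z + b * g z) Z = a * total f Z + b * total g Z := by
  induction Z using Multiset.induction with
  | empty => simp
  | cons z Z ih => simp only [total_cons, ih]; ring

theorem measurable_total {Ω : Type*} {m : MeasurableSpace Ω} {Z : Ω → Contents} {E : Ω → ℕ}
    (f : ℕ → ℕ → ℝ) (hZ : Measurable Z) (hE : Measurable E) :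
    Measurable fun ω => total (f (E ω)) (Z ω) :=
  (Measurable.of_discrete (f := fun p : Contents × ℕ => total (f p.2) p.1)).comp (hZ.prodMk hE)

theorem total_mem_Icc {f : ℕ → ℝ} {b : ℝ} (hf : ∀ z, 0 ≤ f z ∧ f z ≤ b) {N : ℕ} {Z : Contents}
    (hZ : Z.card ≤ N) : 0 ≤ total f Z ∧ total f Z ≤ N * b := by
  refine ⟨total_nonneg (fun z => (hf z).1) Z,
    (total_le_card_mul (fun z => (hf z).2) Z).trans ?_⟩
  exact mul_le_mul_of_nonneg_right (by exact_mod_cast hZ) ((hf 0).1.trans (hf 0).2)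

namespace System

variable {Ω : Type*} {S : System Ω}

theorem measurable_slotCost (w : ℕ → ℕ → ℝ) : Measurable fun p : State × ℝ => slotCost w p.1 p.2 := by
  refine measurable_from_prod_countable_right fun x => ?_
  obtain ⟨O, I, e⟩ := x
  simp only [slotCost]
  induction O using Multiset.induction with
  | empty => simp
  | cons a O ih =>
    simp only [total_cons]
    refine Measurable.add ?_ ih
    split_ifs
    · exact measurable_id
    · exact measurable_id.min measurable_const

/-- A feasible strategy that is determined by the history and by independent randomization. -/
structure IsCausal (S : System Ω) [mΩ : MeasurableSpace Ω] (P : Measure Ω) (A : Strategy Ω) :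
    Prop extends S.IsFeasible A where
  causal : ∃ 𝒢 : MeasurableSpace Ω, 𝒢 ≤ mΩ ∧ Indep 𝒢 S.noise P ∧
    ∀ t, Measurable[𝒢 ⊔ S.history t] (A t)

variable {𝒢 : MeasurableSpace Ω} [mΩ : MeasurableSpace Ω] {P : Measure Ω}

/-- Forgetting the capacity constraint here is what makes one lower bound valid for every `B`. -/
theorem IsAdmissible.isCausal {B : ℕ∞} {A : Strategy Ω} (hA : S.IsAdmissible P B A) :
    S.IsCausal P A where
  subset := hA.subset
  access := hA.access
  causal := by
    obtain ⟨𝒢, h1, h2, h3⟩ := hA.causal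
    exact ⟨𝒢, h1, h2, fun t =>
      @measurable_to_countable' _ _ _ _ (𝒢 ⊔ S.history t) _ (h3 t)⟩

theorem isAdmissible_follow (S : System Ω) [IsProbabilityMeasure P] (τ : ℕ → ℕ → ℝ) :
    S.IsAdmissible P ⊤ (S.follow (thresholdPolicy τ)) where
  subset := (S.isFeasible_follow τ).subset
  access := (S.isFeasible_follow τ).access
  capacity _ _ := le_top
  causal := by
    refine ⟨⊥, bot_le, indep_bot_left _, fun t a => ?_⟩
    rw [bot_sup_eq]
    exact measurable_follow (m := S.history t) τ (fun s hs => S.measurable_C_history hs)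
      (fun s hs => S.measurable_newContents_history hs)
      (fun s hs => S.measurable_isAccess_history hs) (measurableSet_singleton a)

variable {Cmax : ℝ} {Mmax Kmax Dmax : ℕ} {A : Strategy Ω}
  (hS : S.IsModel P Cmax Mmax Kmax Dmax)
include hS

theorem IsModel.measurableSet_isAccess (t : ℕ) : MeasurableSet {ω | S.IsAccess t ω} :=
  measurableSet_setOfPred.2 (measurable_isAccess hS.measurable_D t)

theorem IsModel.measurable_elapsed (t : ℕ) : Measurable (S.elapsed t) :=
  System.measurable_elapsed fun s _ => measurable_isAccess hS.measurable_D s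

theorem IsModel.measurable_newContents (t : ℕ) : Measurable (S.newContents t) :=
  System.measurable_newContents (hS.measurable_M t) (hS.measurable_K t)

theorem IsModel.measurableSet_lastAccess (t : ℕ) (p : ℕ × ℕ) :
    MeasurableSet (S.lastAccess t p) :=
  (((measurable_accessTime fun k _ => hS.measurable_D k).add_const p.2)
    (measurableSet_singleton t)).inter (hS.measurable_D p.1 measurableSet_Ioi)

theorem IsCausal.measurable (hA : S.IsCausal P A) (t : ℕ) : Measurable (A t) := by
  obtain ⟨𝒢, h1, -, h3⟩ := hA.causal
  exact (h3 t).mono (sup_le h1 (hS.history_le (mΩ := mΩ) t)) le_rfl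

theorem IsCausal.measurable_state (hA : S.IsCausal P A) (t : ℕ) : Measurable (S.state A t) :=
  System.measurable_state (fun s _ => hA.measurable hS s)
    (fun s _ => hS.measurable_newContents s) fun s _ => measurable_isAccess hS.measurable_D s

theorem IsCausal.measurable_out (hA : S.IsCausal P A) (t : ℕ) :
    Measurable fun ω => (S.state A t ω).out :=
  (Measurable.of_discrete (f := State.out)).comp (hA.measurable_state hS t)

theorem IsCausal.measurable_remainder (hA : S.IsCausal P A) (t : ℕ) :
    Measurable (S.remainder A t) :=
  System.measurable_remainder (fun s _ => hA.measurable hS s)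
    (fun s _ => hS.measurable_newContents s) fun s _ => measurable_isAccess hS.measurable_D s

theorem IsModel.card_newContents_le (t : ℕ) (ω : Ω) : (S.newContents t ω).card ≤ Mmax := by
  simpa [newContents] using hS.M_le t ω

theorem IsModel.cost_mem (hA : S.IsFeasible A) (t : ℕ) (ω : Ω) :
    0 ≤ ((A t ω).1.card : ℝ) * S.C t ω ∧
      ((A t ω).1.card : ℝ) * S.C t ω ≤ (Mmax * Kmax : ℕ) * Cmax := by
  have h := hS.C_mem t ω
  have h1 := (Multiset.card_le_card (hA.subset t ω).1).trans
    (S.card_out_le hS.M_le hS.K_mem hA t ω)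
  exact ⟨mul_nonneg (Nat.cast_nonneg _) h.1,
    mul_le_mul (by exact_mod_cast h1) h.2 h.1 (Nat.cast_nonneg _)⟩

variable [IsProbabilityMeasure P]

theorem IsModel.integrable_hazard (t : ℕ) :
    Integrable (fun ω => S.hazard P (S.elapsed t ω)) P := by
  refine Integrable.of_bound (C := 1) ((Measurable.of_discrete (f := S.hazard P)).comp
    (hS.measurable_elapsed t)).aestronglyMeasurable (ae_of_all _ fun ω => ?_)
  rw [Real.norm_eq_abs, abs_of_nonneg (S.hazard_nonneg P _)]
  exact S.hazard_le_one P _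

/-- Cut `G` into the countably many disjoint events `lastAccess t p`; on each the elapsed time,
hence the hazard, is constant and `measureReal_isAccess_inter` applies. -/
theorem IsModel.setIntegral_hazard (h𝒢 : 𝒢 ≤ mΩ) (hind : Indep 𝒢 S.noise P) {t : ℕ} {G : Set Ω}
    (hG : MeasurableSet[𝒢 ⊔ S.history t] G) :
    ∫ ω in G, S.hazard P (S.elapsed t ω) ∂P =
      ∫ ω in G, {ω | S.IsAccess (t + 1) ω}.indicator (fun _ => 1) ω ∂P := by
  have hGm : MeasurableSet G := sup_le h𝒢 (hS.history_le t) G hG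
  have hU := hS.measurableSet_isAccess (t + 1)
  have hm : ∀ p, MeasurableSet (G ∩ S.lastAccess t p) := fun p =>
    hGm.inter (hS.measurableSet_lastAccess t p)
  have hd : Pairwise (Function.onFun Disjoint fun p => G ∩ S.lastAccess t p) := fun p q hpq =>
    (S.pairwise_disjoint_lastAccess (fun n ω => (hS.D_mem n ω).1) t hpq).mono
      Set.inter_subset_right Set.inter_subset_right
  have hu : ⋃ p, G ∩ S.lastAccess t p = G := by
    rw [← Set.inter_iUnion, S.iUnion_lastAccess (fun n ω => (hS.D_mem n ω).1), Set.inter_univ]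
  have h1 := hasSum_integral_iUnion (μ := P) hm hd (hS.integrable_hazard t).integrableOn
  have h2 := hasSum_integral_iUnion (μ := P)
    (f := {ω | S.IsAccess (t + 1) ω}.indicator (fun _ => (1 : ℝ))) hm hd
    ((integrable_const 1).indicator hU).integrableOn
  rw [hu] at h1 h2
  refine h1.unique ?_
  convert h2 using 2 with p
  obtain ⟨n, e⟩ := p
  rw [setIntegral_indicator hU, setIntegral_congr_fun (g := fun _ => S.hazard P e) (hm (n, e))
    fun ω hω => by
      simp only [S.elapsed_eq_of_mem_lastAccess (fun n => (hS.D_mem n ω).1) hω.2],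
    setIntegral_const, setIntegral_const, hS.measureReal_isAccess_inter h𝒢 hind hG]
  simp only [smul_eq_mul]
  ring

theorem IsModel.integrable_total {f : ℕ → ℕ → ℝ} {b : ℝ} (hf : ∀ e z, 0 ≤ f e z ∧ f e z ≤ b)
    {Z : Ω → Contents} (hZ : Measurable Z) {N : ℕ} (hN : ∀ ω, (Z ω).card ≤ N) (t : ℕ) :
    Integrable (fun ω => total (f (S.elapsed t ω)) (Z ω)) P := by
  refine Integrable.of_bound (C := N * b)
    (measurable_total f hZ (hS.measurable_elapsed t)).aestronglyMeasurable
    (ae_of_all _ fun ω => ?_)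
  have h := total_mem_Icc (hf (S.elapsed t ω)) (hN ω)
  rw [Real.norm_eq_abs, abs_of_nonneg h.1]
  exact h.2

/-- The expected cost of the remaining contents, before and after it is known whether the user
accesses in the next slot. -/
theorem IsModel.integral_total_remainder_of_measurable (hA : S.IsFeasible A) (h𝒢 : 𝒢 ≤ mΩ)
    (hind : Indep 𝒢 S.noise P) (hmeas : ∀ t, Measurable[𝒢 ⊔ S.history t] (A t)) (t : ℕ) :
    ∫ ω, total (S.contentCost P (S.elapsed (t + 1) ω)) (S.remainder A t ω) ∂P =
      ∫ ω, total (S.waitingCost P (S.elapsed t ω)) (S.remainder A t ω) ∂P := by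
  set R := S.remainder A t with hR
  have hcard := S.card_remainder_le hS.M_le hS.K_mem hA t
  have hm : 𝒢 ⊔ S.history t ≤ mΩ := sup_le h𝒢 (hS.history_le t)
  have hRm : Measurable[𝒢 ⊔ S.history t] R :=
    System.measurable_remainder (m := 𝒢 ⊔ S.history t)
      (fun s hs => (hmeas s).mono (sup_le_sup_left (S.history_mono hs) _) le_rfl)
      (fun s hs => (S.measurable_newContents_history hs).mono le_sup_right le_rfl)
      fun s hs => (S.measurable_isAccess_history hs).mono le_sup_right le_rfl
  have hEm : Measurable[𝒢 ⊔ S.history t] (S.elapsed t) :=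
    System.measurable_elapsed (m := 𝒢 ⊔ S.history t)
      fun s hs => (S.measurable_isAccess_history hs).mono le_sup_right le_rfl
  set Y₁ : Ω → ℝ := fun ω => total (S.contentCost P (S.elapsed t ω + 1)) (R ω) with hY₁
  -- The next elapsed time is `E_t + 1` without an access and `0` with one. `Y₁` is the value in the
  -- former case, `Y₂` the correction due to an access; both are known in slot `t`, so the
  -- conditional probability may replace the indicator.
  set Y₂ : Ω → ℝ := fun ω => total (S.contentCost P 0) (R ω) - Y₁ ω with hY₂
  set U : Set Ω := {ω | S.IsAccess (t + 1) ω} with hU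
  have hY₁m : Measurable[𝒢 ⊔ S.history t] Y₁ :=
    measurable_total (m := 𝒢 ⊔ S.history t) (fun e => S.contentCost P (e + 1)) hRm hEm
  have hY₂m : Measurable[𝒢 ⊔ S.history t] Y₂ :=
    (measurable_total (m := 𝒢 ⊔ S.history t) (fun _ => S.contentCost P 0) hRm hEm).sub hY₁m
  have b₁ : ∀ ω, 0 ≤ Y₁ ω ∧ Y₁ ω ≤ (Mmax * Kmax : ℕ) * Cmax := fun ω =>
    total_mem_Icc (hS.contentCost_mem _) (hcard ω)
  have b₂ : ∀ ω, |Y₂ ω| ≤ (Mmax * Kmax : ℕ) * Cmax := fun ω => by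
    have h1 := total_mem_Icc (hS.contentCost_mem 0) (hcard ω)
    have h2 := b₁ ω
    rw [abs_le]
    constructor <;> simp only [hY₂] <;> linarith
  have i₁ : Integrable Y₁ P := Integrable.of_bound (hY₁m.mono hm le_rfl).aestronglyMeasurable
    ((Mmax * Kmax : ℕ) * Cmax) (ae_of_all _ fun ω => by
      rw [Real.norm_eq_abs, abs_of_nonneg (b₁ ω).1]; exact (b₁ ω).2)
  have i₂ : Integrable Y₂ P := Integrable.of_bound (hY₂m.mono hm le_rfl).aestronglyMeasurable
    ((Mmax * Kmax : ℕ) * Cmax) (ae_of_all _ b₂)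
  have hUm : MeasurableSet U := hS.measurableSet_isAccess (t + 1)
  have hh : Measurable[𝒢 ⊔ S.history t] fun ω => S.hazard P (S.elapsed t ω) :=
    (Measurable.of_discrete (f := S.hazard P)).comp hEm
  have i₃ : Integrable (fun ω => Y₂ ω * S.hazard P (S.elapsed t ω)) P :=
    (hS.integrable_hazard t).bdd_mul (hY₂m.mono hm le_rfl).aestronglyMeasurable (ae_of_all _ b₂)
  have key := integral_indicator_eq_integral_mul hm hUm hh (hS.integrable_hazard t) hY₂m b₂
    fun G hG => hS.setIntegral_hazard h𝒢 hind hG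
  have e₁ : ∀ ω, total (S.contentCost P (S.elapsed (t + 1) ω)) (R ω) = Y₁ ω + U.indicator Y₂ ω := by
    intro ω
    rw [S.elapsed_succ]
    by_cases h : S.IsAccess (t + 1) ω
    · rw [if_pos h, Set.indicator_of_mem (show ω ∈ U from h)]
      simp [hY₂]
    · rw [if_neg h, Set.indicator_of_notMem (show ω ∉ U from h), add_zero]
  have e₂ : ∀ ω, total (S.waitingCost P (S.elapsed t ω)) (R ω) =
      Y₁ ω + Y₂ ω * S.hazard P (S.elapsed t ω) := by
    intro ω
    -- Remaining contents have positive lifetime, as `waitingCost_of_pos` demands.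
    rw [total_congr fun z hz => S.waitingCost_of_pos P (S.elapsed t ω) (S.pos_of_mem_remainder hz),
      total_linear]
    simp only [hY₂, hY₁]
    ring
  simp_rw [e₁, e₂]
  rw [integral_add i₁ (i₂.indicator hUm), integral_add i₁ i₃, key]

theorem IsModel.integral_total_remainder (hA : S.IsCausal P A) (t : ℕ) :
    ∫ ω, total (S.contentCost P (S.elapsed (t + 1) ω)) (S.remainder A t ω) ∂P =
      ∫ ω, total (S.waitingCost P (S.elapsed t ω)) (S.remainder A t ω) ∂P := by
  obtain ⟨𝒢, h𝒢, hind, hmeas⟩ := hA.causal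
  exact hS.integral_total_remainder_of_measurable (mΩ := mΩ) (IsCausal.toIsFeasible (mΩ := mΩ) hA)
    h𝒢 hind hmeas t

/-! ### Averaging over the current price -/

/-- The state in slot `t` is built from actions of earlier slots, so it is measurable with respect
to the randomization, the arrivals, the gaps and the prices of other slots. -/
theorem IsModel.indepFun_state_C_of_measurable (h𝒢 : 𝒢 ≤ mΩ) (hind : Indep 𝒢 S.noise P)
    (hmeas : ∀ t, Measurable[𝒢 ⊔ S.history t] (A t)) (t : ℕ) :
    IndepFun (S.state A t) (S.C t) P := by
  have h := hS.indep_C_rest h𝒢 hind t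
  refine indep_of_indep_of_le_left h (Measurable.comap_le ?_)
  have hle : S.numbers ⊔ S.lifetimes ⊔ S.gaps ≤
      𝒢 ⊔ (S.numbers ⊔ S.lifetimes ⊔ S.gaps) ⊔
      ⨆ s ∈ ({t}ᶜ : Set ℕ), MeasurableSpace.comap (S.C s) inferInstance :=
    le_sup_right.trans le_sup_left
  have hN := S.measurable_newContents_of_le ((le_sup_left.trans le_sup_left).trans hle)
    ((le_sup_right.trans le_sup_left).trans hle)
  have hU := S.measurable_isAccess_of_le (le_sup_right.trans hle)
  refine System.measurable_state (fun s hs => (hmeas s).mono (sup_le ?_ ?_) le_rfl)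
    (fun s _ => hN s) fun s _ => hU s
  · exact le_sup_left.trans le_sup_left
  · refine S.history_le (fun r hr => ?_) (fun r _ => hN r) fun r _ => hU r
    exact measurable_of_comap_le ((le_iSup₂
      (f := fun s (_ : s ∈ ({t}ᶜ : Set ℕ)) => MeasurableSpace.comap (S.C s) inferInstance) r
      (by simp only [Set.mem_compl_iff, Set.mem_singleton_iff]; omega)).trans le_sup_right)

theorem IsModel.indepFun_state_C (hA : S.IsCausal P A) (t : ℕ) :
    IndepFun (S.state A t) (S.C t) P := by
  obtain ⟨𝒢, h𝒢, hind, hmeas⟩ := hA.causal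
  exact hS.indepFun_state_C_of_measurable (mΩ := mΩ) h𝒢 hind hmeas t

theorem IsModel.slotCost_mem (hA : S.IsFeasible A) (t : ℕ) (ω : Ω) :
    0 ≤ slotCost (fun e z => S.waitingCost P e (z - 1)) (S.state A t ω) (S.C t ω) ∧
    slotCost (fun e z => S.waitingCost P e (z - 1)) (S.state A t ω) (S.C t ω) ≤
      (Mmax * Kmax : ℕ) * Cmax := by
  unfold slotCost
  have hcard := S.card_out_le hS.M_le hS.K_mem hA t ω
  refine total_mem_Icc (fun z => ?_) hcard
  have h := hS.C_mem t ω
  split_ifs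
  · exact h
  · exact ⟨le_min h.1 (hS.waitingCost_mem _ _).1, (min_le_left _ _).trans h.2⟩

theorem IsCausal.integrable_slotCost (hA : S.IsCausal P A) (t : ℕ) :
    Integrable (fun ω =>
      slotCost (fun e z => S.waitingCost P e (z - 1)) (S.state A t ω) (S.C t ω)) P := by
  have hm : Measurable fun ω =>
      slotCost (fun e z => S.waitingCost P e (z - 1)) (S.state A t ω) (S.C t ω) :=
    (measurable_slotCost fun e z => S.waitingCost P e (z - 1)).comp
      ((hA.measurable_state hS t).prodMk (hS.measurable_C t))
  refine Integrable.of_bound (C := (Mmax * Kmax : ℕ) * Cmax) hm.aestronglyMeasurable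
    (ae_of_all _ fun ω => ?_)
  have h := hS.slotCost_mem hA.toIsFeasible t ω
  rw [Real.norm_eq_abs, abs_of_nonneg h.1]
  exact h.2

/-- By independence the joint law of state and price is a product; Fubini reduces the claim to a
fixed state. -/
theorem IsModel.integral_slotCost_state (hA : S.IsCausal P A) (t : ℕ) :
    ∫ ω, slotCost (fun e z => S.waitingCost P e (z - 1)) (S.state A t ω) (S.C t ω) ∂P =
      ∫ ω, total (S.contentCost P (S.elapsed t ω)) (S.state A t ω).out ∂P := by
  set w := fun e z => S.waitingCost P e (z - 1) with hw
  have hX := hA.measurable_state hS t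
  have hC := hS.measurable_C t
  have hq := measurable_slotCost w
  have hmap := (indepFun_iff_map_prod_eq_prod_map_map hX.aemeasurable hC.aemeasurable).1
    (hS.indepFun_state_C hA t)
  have hi : Integrable (fun p : State × ℝ => slotCost w p.1 p.2)
      ((P.map (S.state A t)).prod (P.map (S.C t))) := by
    rw [← hmap, integrable_map_measure hq.aestronglyMeasurable (hX.prodMk hC).aemeasurable]
    exact hA.integrable_slotCost hS t
  have h1 := integral_map (μ := P) (hX.prodMk hC).aemeasurable
    (f := fun p : State × ℝ => slotCost w p.1 p.2) hq.aestronglyMeasurable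
  rw [← h1, hmap, integral_prod _ hi]
  have h2 : ∀ x, ∫ c, slotCost w x c ∂(P.map (S.C t)) = total (S.contentCost P x.elapsed) x.out := by
    intro x
    have hqx : Measurable fun c => slotCost w x c := hq.comp measurable_prodMk_left
    rw [(hS.ident_C t).map_eq, integral_map (hS.measurable_C 0).aemeasurable
      hqx.aestronglyMeasurable]
    exact (hS.integral_slotCost x).2
  simp only [h2]
  rw [integral_map hX.aemeasurable Measurable.of_discrete.aestronglyMeasurable]
  simp only [S.state_elapsed]

theorem IsCausal.integrable_cost (hA : S.IsCausal P A) (t : ℕ) :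
    Integrable (fun ω => ((A t ω).1.card : ℝ) * S.C t ω) P := by
  refine Integrable.of_bound (C := (Mmax * Kmax : ℕ) * Cmax)
    (((Measurable.of_discrete (f := fun a : Action => (a.1.card : ℝ))).comp
      (hA.measurable hS t)).mul (hS.measurable_C t)).aestronglyMeasurable
    (ae_of_all _ fun ω => ?_)
  have h := hS.cost_mem hA.toIsFeasible t ω
  rw [Real.norm_eq_abs, abs_of_nonneg h.1]
  exact h.2

theorem IsCausal.integrable_waitingCost (hA : S.IsCausal P A) (t : ℕ) :
    Integrable (fun ω => total (S.waitingCost P (S.elapsed t ω)) (S.remainder A t ω)) P :=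
  hS.integrable_total hS.waitingCost_mem (hA.measurable_remainder hS t)
    (S.card_remainder_le hS.M_le hS.K_mem hA.toIsFeasible t) t

/-! ### Verification: the expected debt as potential, telescoping and the limit -/

/-- The expected cost of the contents outside the cache at the beginning of slot `t`, if the
threshold policy is followed from then on. -/
def expectedDebt (S : System Ω) (P : Measure Ω) (A : Strategy Ω) (t : ℕ) : ℝ :=
  ∫ ω, total (S.contentCost P (S.elapsed t ω)) (S.state A t ω).out ∂P

/-- The expected cost of the contents that are new in slot `t`. -/
def expectedNewDebt (S : System Ω) (P : Measure Ω) (t : ℕ) : ℝ :=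
  ∫ ω, total (S.contentCost P (S.elapsed t ω)) (S.newContents t ω) ∂P

theorem IsModel.expectedDebt_succ (hA : S.IsCausal P A) (t : ℕ) :
    S.expectedDebt P A (t + 1) =
      ∫ ω, total (S.waitingCost P (S.elapsed t ω)) (S.remainder A t ω) ∂P +
        S.expectedNewDebt P (t + 1) := by
  unfold expectedDebt expectedNewDebt
  simp_rw [S.state_succ_out, total_add]
  rw [integral_add, hS.integral_total_remainder hA]
  · exact hS.integrable_total hS.contentCost_mem (hA.measurable_remainder hS t)
      (S.card_remainder_le hS.M_le hS.K_mem hA.toIsFeasible t) _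
  · exact hS.integrable_total hS.contentCost_mem (hS.measurable_newContents _)
      (hS.card_newContents_le _) _

theorem IsModel.expectedDebt_mem (hA : S.IsCausal P A) (t : ℕ) :
    0 ≤ S.expectedDebt P A t ∧ S.expectedDebt P A t ≤ (Mmax * Kmax : ℕ) * Cmax := by
  have hcard := S.card_out_le hS.M_le hS.K_mem hA.toIsFeasible t
  have h := fun ω => total_mem_Icc (hS.contentCost_mem (S.elapsed t ω)) (hcard ω)
  refine ⟨integral_nonneg fun ω => (h ω).1, ?_⟩
  unfold expectedDebt
  simpa using integral_mono
    (hS.integrable_total hS.contentCost_mem (hA.measurable_out hS t) hcard t)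
    (integrable_const _) fun ω => (h ω).2

/-- The Bellman inequality in expectation: the debt is the mean of `slotCost`, which `slotCost_le`
bounds path by path, and the waiting cost of the remainder is the old part of the next debt. -/
theorem IsModel.expectedDebt_le (hA : S.IsCausal P A) (t : ℕ) :
    S.expectedDebt P A t + S.expectedNewDebt P (t + 1) ≤
      ∫ ω, ((A t ω).1.card : ℝ) * S.C t ω ∂P + S.expectedDebt P A (t + 1) := by
  rw [hS.expectedDebt_succ hA, ← add_assoc, ← integral_add (hA.integrable_cost hS t)
    (hA.integrable_waitingCost hS t), expectedDebt, ← hS.integral_slotCost_state hA]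
  refine add_le_add_left (integral_mono (hA.integrable_slotCost hS t)
    ((hA.integrable_cost hS t).add (hA.integrable_waitingCost hS t)) fun ω => ?_) _
  exact S.slotCost_le (fun e z => (hS.waitingCost_mem e z).1) (S.waitingCost_zero P)
    hA.toIsFeasible t ω _

theorem IsModel.expectedDebt_follow
    (hA : S.IsCausal P (S.follow (thresholdPolicy fun e z => S.waitingCost P e (z - 1)))) (t : ℕ) :
    S.expectedDebt P (S.follow (thresholdPolicy fun e z => S.waitingCost P e (z - 1))) t +
        S.expectedNewDebt P (t + 1) =
      ∫ ω, ((S.follow (thresholdPolicy fun e z => S.waitingCost P e (z - 1)) t ω).1.card : ℝ) *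
        S.C t ω ∂P +
      S.expectedDebt P (S.follow (thresholdPolicy fun e z => S.waitingCost P e (z - 1))) (t + 1) := by
  rw [hS.expectedDebt_succ hA, ← add_assoc, ← integral_add (hA.integrable_cost hS t)
    (hA.integrable_waitingCost hS t), expectedDebt, ← hS.integral_slotCost_state hA]
  simp_rw [S.slotCost_follow (S.waitingCost_zero P)]

/-- The access in slot `0` leaves nothing behind, so all strategies start with the same debt. -/
theorem IsModel.expectedDebt_one (hA : S.IsCausal P A) :
    S.expectedDebt P A 1 = S.expectedNewDebt P 1 := by
  rw [hS.expectedDebt_succ hA]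
  simp [remainder, S.isAccess_zero]

/-- Telescoping. The left-hand side does not involve the strategy and thus serves as the common
yardstick. -/
theorem IsModel.sum_expectedNewDebt_le (hA : S.IsCausal P A) (T : ℕ) :
    ∑ t ∈ Finset.range (T + 1), S.expectedNewDebt P (t + 1) ≤
      ∑ t ∈ Finset.Icc 1 T, ∫ ω, ((A t ω).1.card : ℝ) * S.C t ω ∂P +
        S.expectedDebt P A (T + 1) := by
  induction T with
  | zero => simp [hS.expectedDebt_one hA]
  | succ T ih =>
    rw [Finset.sum_range_succ, Finset.sum_Icc_succ_top (by omega)]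
    have := hS.expectedDebt_le hA (T + 1)
    linarith

theorem IsModel.sum_expectedNewDebt_eq
    (hA : S.IsCausal P (S.follow (thresholdPolicy fun e z => S.waitingCost P e (z - 1)))) (T : ℕ) :
    ∑ t ∈ Finset.range (T + 1), S.expectedNewDebt P (t + 1) =
      ∑ t ∈ Finset.Icc 1 T,
        ∫ ω, ((S.follow (thresholdPolicy fun e z => S.waitingCost P e (z - 1)) t ω).1.card : ℝ) *
          S.C t ω ∂P +
        S.expectedDebt P (S.follow (thresholdPolicy fun e z => S.waitingCost P e (z - 1)))
          (T + 1) := by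
  induction T with
  | zero => simp [hS.expectedDebt_one hA]
  | succ T ih =>
    rw [Finset.sum_range_succ, Finset.sum_Icc_succ_top (by omega)]
    have := hS.expectedDebt_follow hA (T + 1)
    linarith

theorem IsCausal.integral_averageCost (hA : S.IsCausal P A) (T : ℕ) :
    ∫ ω, S.averageCost A T ω ∂P =
      (1 / (T : ℝ)) * ∑ t ∈ Finset.Icc 1 T, ∫ ω, ((A t ω).1.card : ℝ) * S.C t ω ∂P := by
  unfold averageCost
  rw [integral_const_mul, integral_finsetSum _ fun t _ => hA.integrable_cost hS t]

theorem IsCausal.integral_averageCost_mem (hA : S.IsCausal P A) (T : ℕ) :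
    0 ≤ ∫ ω, S.averageCost A T ω ∂P ∧
      ∫ ω, S.averageCost A T ω ∂P ≤ (Mmax * Kmax : ℕ) * Cmax := by
  rw [hA.integral_averageCost hS]
  have hb : 0 ≤ ((Mmax * Kmax : ℕ) : ℝ) * Cmax := mul_nonneg (Nat.cast_nonneg _) hS.Cmax_nonneg
  constructor
  · exact mul_nonneg (by positivity) (Finset.sum_nonneg fun t _ =>
      integral_nonneg fun ω => (hS.cost_mem hA.toIsFeasible t ω).1)
  · have h : ∑ t ∈ Finset.Icc 1 T, ∫ ω, ((A t ω).1.card : ℝ) * S.C t ω ∂P ≤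
        T * ((Mmax * Kmax : ℕ) * Cmax) := by
      refine (Finset.sum_le_card_nsmul _ _ ((Mmax * Kmax : ℕ) * Cmax) fun t _ => ?_).trans
        (by simp)
      simpa using integral_mono (hA.integrable_cost hS t) (integrable_const _)
        fun ω => (hS.cost_mem hA.toIsFeasible t ω).2
    rcases Nat.eq_zero_or_pos T with rfl | hT
    · simpa using hb
    · have hT' : (0 : ℝ) < T := by exact_mod_cast hT
      rw [one_div, inv_mul_le_iff₀ hT']
      exact h

theorem IsModel.longTermCost_follow_le {B : ℕ∞} (hA : S.IsAdmissible P B A) :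
    S.longTermCost P (S.follow (thresholdPolicy fun e z => S.waitingCost P e (z - 1))) ≤
      S.longTermCost P A := by
  have hA := hA.isCausal
  have hτ := (S.isAdmissible_follow (P := P) fun e z => S.waitingCost P e (z - 1)).isCausal
  set b : ℝ := (Mmax * Kmax : ℕ) * Cmax
  have hle : ∀ T : ℕ, ∫ ω, S.averageCost
      (S.follow (thresholdPolicy fun e z => S.waitingCost P e (z - 1))) T ω ∂P ≤
      ∫ ω, S.averageCost A T ω ∂P + b / T := by
    intro T
    rw [hτ.integral_averageCost hS, hA.integral_averageCost hS, show b / (T : ℝ) = 1 / T * b by ring,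
      ← mul_add]
    refine mul_le_mul_of_nonneg_left ?_ (by positivity)
    -- The strategies differ only by their final debts: at most `b` for `A`, at least `0` for the
    -- threshold policy.
    have h1 := hS.sum_expectedNewDebt_le hA T
    have h2 := hS.sum_expectedNewDebt_eq hτ T
    have h3 := (hS.expectedDebt_mem hA (T + 1)).2
    have h4 := (hS.expectedDebt_mem hτ (T + 1)).1
    linarith
  -- A real `limsup` is meaningful only for bounded sequences, so both bounds are recorded for every
  -- causal strategy.
  have bdd : ∀ {A : Strategy Ω}, S.IsCausal P A →
      IsBoundedUnder (· ≤ ·) atTop (fun T : ℕ => ∫ ω, S.averageCost A T ω ∂P) ∧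
      IsCoboundedUnder (· ≤ ·) atTop (fun T : ℕ => ∫ ω, S.averageCost A T ω ∂P) := fun hA =>
    ⟨isBoundedUnder_of ⟨b, fun T => (hA.integral_averageCost_mem hS T).2⟩,
      IsBoundedUnder.isCoboundedUnder_le
        (isBoundedUnder_of ⟨0, fun T => (hA.integral_averageCost_mem hS T).1⟩)⟩
  refine le_of_forall_pos_le_add fun ε hε => ?_
  unfold longTermCost
  rw [← limsup_add_const atTop _ ε (bdd hA).1 (bdd hA).2]
  refine limsup_le_limsup ?_ (bdd hτ).2 ?_
  · have ht : Tendsto (fun T : ℕ => b / (T : ℝ)) atTop (nhds 0) :=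
      tendsto_const_div_atTop_nhds_zero_nat b
    filter_upwards [ht.eventually (gt_mem_nhds hε)] with T hT
    have := hle T
    linarith
  · exact isBoundedUnder_of
      ⟨b + ε, fun T => by have := (hA.integral_averageCost_mem hS T).2; linarith⟩

end System

end Caching

end

theorem corollary1 {Ω : Type*} [MeasurableSpace Ω] (P : Measure Ω) [IsProbabilityMeasure P]
    (S : Caching.System Ω) (Cmax : ℝ) (Mmax Kmax Dmax : ℕ)
    (hS : S.IsModel P Cmax Mmax Kmax Dmax) :
    ∃ τ : ℕ → ℕ → ℝ,
      (∀ E, 0 < E → 0 ≤ τ E 1 ∧ MonotoneOn (τ E) (Set.Icc 1 Kmax) ∧ τ E Kmax ≤ Cmax) ∧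
      S.IsOptimal P ⊤ (S.follow (Caching.thresholdPolicy τ)) ∧
      ∀ (B : ℕ) (A : Caching.Strategy Ω), S.IsAdmissible P B A →
        S.longTermCost P (S.follow (Caching.thresholdPolicy τ)) ≤ S.longTermCost P A := by
  -- A content of lifetime `z` left outside now is relevant for `z - 1` further slots. In particular
  -- the threshold for `z = 1` is `0`.
  refine ⟨fun e z => S.waitingCost P e (z - 1), fun e _ => ⟨(hS.waitingCost_mem e _).1, ?_, ?_⟩,
    ⟨S.isAdmissible_follow _, fun A hA => hS.longTermCost_follow_le hA⟩,
    fun B A hA => hS.longTermCost_follow_le hA⟩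
  · exact fun y _ z _ hyz => hS.monotone_waitingCost e (Nat.sub_le_sub_right hyz 1)
  · exact (hS.waitingCost_mem e _).2.trans hS.integral_C_mem.2
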